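/- Let $R$ be an associative ring with unity. A left $R$-module $F$ is flat if $(-)\otimes_R F$ is an exact functor on right $R$-modules. A class of modules is $\lambda$-categorical, for a cardinal $\lambda$, if it contains a module of cardinality $\lambda$ and any two modules of cardinality $\lambda$ in it are isomorphic. The ring $R$ is left perfect if every countably generated flat left $R$-module is projective; $J(R)$ denotes the Jacobson radical, the intersection of all maximal left ideals. A ring is local if it is non-zero and the sum of any two non-invertible elements is non-invertible. An ideal $I$ is left $T$-nilpotent if for every sequence $(a_i)_{i<\omega}$ in $I$ there is $n\ge 1$ with $a_0a_1\cdots a_{n-1}=0$. The following are equivalent: 1. The class of flat left $R$-modules is $\lambda$-categorical for all cardinals $\lambda>\mathrm{card}(R)+\aleph_0$. 2. The class of flat left $R$-modules is $\lambda$-categorical for some cardinal $\lambda>\mathrm{card}(R)+\aleph_0$. 3. $R$ is left perfect and $R/J(R)\cong M_n(D)$ for some division ring $D$ and some $n\ge 1$. 4. $R\cong M_n(k)$ for some $n\ge 1$ and some local ring $k$ whose maximal ideal is left $T$-nilpotent. -/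

import Mathlib

open scoped TensorProduct

universe u

namespace FlatCat

section Tensor

variable (R : Type u) [Ring R]

/-- Relations `(a r) ⊗ m = a ⊗ (r m)` in `A ⊗[ℤ] M`, for a right `R`-module `A` (that is, a left
module over `Rᵐᵒᵖ`) and a left `R`-module `M`. -/
def balancedRel (A M : Type u) [AddCommGroup A] [Module Rᵐᵒᵖ A] [AddCommGroup M] [Module R M] :
    AddSubgroup (A ⊗[ℤ] M) :=
  AddSubgroup.closure {t | ∃ (a : A) (r : R) (m : M),
    t = (MulOpposite.op r • a) ⊗ₜ[ℤ] m - a ⊗ₜ[ℤ] (r • m)}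

/-- The tensor product `A ⊗_R M` of a right `R`-module and a left `R`-module over a ring `R` that
need not be commutative; it is an abelian group. -/
abbrev Tensor (A M : Type u) [AddCommGroup A] [Module Rᵐᵒᵖ A] [AddCommGroup M] [Module R M] :
    Type u :=
  (A ⊗[ℤ] M) ⧸ balancedRel R A M

/-- The homomorphism `f ⊗ M : A ⊗_R M → B ⊗_R M` induced by a homomorphism `f : A → B` of right
`R`-modules. -/
def Tensor.map {A B : Type u} (M : Type u) [AddCommGroup A] [Module Rᵐᵒᵖ A]
    [AddCommGroup B] [Module Rᵐᵒᵖ B] [AddCommGroup M] [Module R M] (f : A →ₗ[Rᵐᵒᵖ] B) :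
    Tensor R A M →+ Tensor R B M :=
  QuotientAddGroup.map (balancedRel R A M) (balancedRel R B M)
    (LinearMap.rTensor M f.toAddMonoidHom.toIntLinearMap).toAddMonoidHom (by
      refine (AddSubgroup.closure_le _).2 ?_
      rintro _ ⟨a, r, m, rfl⟩
      exact AddSubgroup.subset_closure ⟨f a, r, m, by simp⟩)

/-- A left `R`-module `M` is flat if the functor `(-) ⊗_R M` on right `R`-modules is exact. -/
def IsFlat (M : Type u) [AddCommGroup M] [Module R M] : Prop :=
  ∀ (A B C : Type u) [AddCommGroup A] [AddCommGroup B] [AddCommGroup C]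
    [Module Rᵐᵒᵖ A] [Module Rᵐᵒᵖ B] [Module Rᵐᵒᵖ C] (f : A →ₗ[Rᵐᵒᵖ] B) (g : B →ₗ[Rᵐᵒᵖ] C),
    Function.Exact f g → Function.Exact (Tensor.map R M f) (Tensor.map R M g)

/-- The class of flat left `R`-modules. -/
def flatModules : ModuleCat.{u} R → Prop := fun M => IsFlat R M

/-- `R` is left perfect: every countably generated flat left `R`-module is projective. -/
def IsLeftPerfect : Prop :=
  ∀ (M : Type u) [AddCommGroup M] [Module R M],
    (∃ s : Set M, s.Countable ∧ Submodule.span R s = ⊤) → IsFlat R M → Module.Projective R M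

end Tensor

/-- A class `K` of left `R`-modules is categorical in the cardinal `c`: it has a member of
cardinality `c`, and any two members of cardinality `c` are isomorphic. -/
def IsCategoricalIn {R : Type u} [Ring R] (K : ModuleCat.{u} R → Prop) (c : Cardinal.{u}) : Prop :=
  (∃ M : ModuleCat.{u} R, K M ∧ Cardinal.mk M = c) ∧
    ∀ M N : ModuleCat.{u} R, K M → K N → Cardinal.mk M = c → Cardinal.mk N = c →
      Nonempty (M ≃ₗ[R] N)

/-- `I` is left T-nilpotent: for all `a 0, a 1, …` in `I`, some product
`a 0 * a 1 * ⋯ * a (n - 1)` with `n ≥ 1` vanishes. -/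
def IsLeftTNilpotent {R : Type u} [Ring R] (I : Ideal R) : Prop :=
  ∀ a : ℕ → R, (∀ i, a i ∈ I) → ∃ n : ℕ, 1 ≤ n ∧ ((List.range n).map a).prod = 0

end FlatCat

/-! All four conditions amount to the existence of a local progenerator: an idempotent `e` with `R e
R = R` whose corner `e R e` is local with left T-nilpotent maximal ideal. Given such an `e`, flat
modules behave like vector spaces: each is a direct sum of copies of `R e`
(`IsLocalProgenerator.exists_linearEquiv_of_isFlat`). A basis is a maximal subset of `e M`
independent modulo `J M`. It spans by the T-nilpotent form of Nakayama's lemma, and it is free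
because, by the equational criterion for flatness, a relation between its elements is a row vector
fixed by a matrix over `J`. Beyond `card R + ℵ₀` the cardinality of the module is the number of
summands, whence categoricity. Applied to `R` itself, the decomposition gives `R ≅ M_n(k)` with `k`
the opposite of `End (R e)`.

Conversely, categoricity in `c` makes `M^(c)` free for every nonzero flat `M` of cardinality at most
`c` (`IsCategoricalIn.nonempty_linearEquiv`). With `M` a Bass module this yields the descending
chain condition on principal right ideals, which makes `J` T-nilpotent and produces an idempotent
`e` that is local modulo `J`. With `M = R e` it yields `R e R = R`. Under condition 3, left
perfectness gives the same chain condition, and a diagonal matrix unit of `M_n(D)` lifts modulo `J`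
to a local progenerator. -/

namespace FlatCat

/-! ### Tensor products over a noncommutative ring -/

section TensorBasics

variable {R : Type u} [Ring R]

section Defs

variable {A B C M N : Type u} [AddCommGroup A] [Module Rᵐᵒᵖ A] [AddCommGroup B] [Module Rᵐᵒᵖ B]
  [AddCommGroup C] [Module Rᵐᵒᵖ C]
  [AddCommGroup M] [Module R M] [AddCommGroup N] [Module R N]

variable (R) in
/-- The pure tensor `a ⊗ m`. -/
def tmul (a : A) (m : M) : Tensor R A M := QuotientAddGroup.mk (a ⊗ₜ[ℤ] m)

theorem tmul_add (a : A) (m m' : M) : tmul R a (m + m') = tmul R a m + tmul R a m' := by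
  simp only [tmul, TensorProduct.tmul_add]; rfl

theorem add_tmul (a a' : A) (m : M) : tmul R (a + a') m = tmul R a m + tmul R a' m := by
  simp only [tmul, TensorProduct.add_tmul]; rfl

theorem op_smul_tmul (r : R) (a : A) (m : M) :
    tmul R (MulOpposite.op r • a) m = tmul R a (r • m) := by
  refine sub_eq_zero.1 ?_
  exact (QuotientAddGroup.eq_zero_iff _).2 (AddSubgroup.subset_closure ⟨a, r, m, rfl⟩)

variable (R A M) in
/-- The pure tensor as a biadditive map. -/
def tmulHom : A →+ M →+ Tensor R A M :=
  AddMonoidHom.mk' (fun a => AddMonoidHom.mk' (tmul R a) (tmul_add a))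
    fun a a' => by ext m; exact add_tmul a a' m

@[simp] theorem tmulHom_apply (a : A) (m : M) : tmulHom R A M a m = tmul R a m := rfl

@[simp] theorem tmul_zero (a : A) : tmul R a (0 : M) = 0 := (tmulHom R A M a).map_zero

@[simp] theorem zero_tmul (m : M) : tmul R (0 : A) m = 0 :=
  DFunLike.congr_fun (tmulHom R A M).map_zero m

theorem tmul_sum {ι : Type*} (s : Finset ι) (a : A) (m : ι → M) :
    tmul R a (∑ i ∈ s, m i) = ∑ i ∈ s, tmul R a (m i) := map_sum (tmulHom R A M a) m s

@[elab_as_elim]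
theorem tensor_induction {p : Tensor R A M → Prop} (t : Tensor R A M)
    (zero : p 0) (tmul : ∀ a m, p (tmul R a m)) (add : ∀ s t, p s → p t → p (s + t)) : p t := by
  obtain ⟨t, rfl⟩ := QuotientAddGroup.mk_surjective t
  induction t using TensorProduct.induction_on with
  | zero => exact zero
  | tmul a m => exact tmul a m
  | add x y hx hy => exact add _ _ hx hy

/-- The homomorphism out of the tensor product given by a balanced biadditive map. -/
def tensorLift {G : Type*} [AddCommGroup G] (f : A →+ M →+ G)
    (h : ∀ a (r : R) m, f (MulOpposite.op r • a) m = f a (r • m)) : Tensor R A M →+ G :=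
  QuotientAddGroup.lift (balancedRel R A M)
    (TensorProduct.liftAddHom f fun r a m => by simp) (by
      refine (AddSubgroup.closure_le _).2 ?_
      rintro _ ⟨a, r, m, rfl⟩
      simp [h])

@[simp] theorem tensorLift_tmul {G : Type*} [AddCommGroup G] (f : A →+ M →+ G)
    (h : ∀ a (r : R) m, f (MulOpposite.op r • a) m = f a (r • m)) (a : A) (m : M) :
    tensorLift f h (tmul R a m) = f a m := rfl

@[simp] theorem map_tmul (f : A →ₗ[Rᵐᵒᵖ] B) (a : A) (m : M) :
    Tensor.map R M f (tmul R a m) = tmul R (f a) m := rfl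

variable (A) in
/-- The homomorphism `A ⊗ h` induced by a homomorphism `h` of left modules. -/
def lmap (h : M →ₗ[R] N) : Tensor R A M →+ Tensor R A N :=
  tensorLift ((tmulHom R A N).compr₂ (AddMonoidHom.id _) |>.compl₂ h.toAddMonoidHom)
    fun a r m => by simp [op_smul_tmul]

@[simp] theorem lmap_tmul (h : M →ₗ[R] N) (a : A) (m : M) :
    lmap A h (tmul R a m) = tmul R a (h m) := rfl

theorem tensor_hom_ext {G : Type*} [AddCommGroup G] {f g : Tensor R A M →+ G}
    (h : ∀ a m, f (tmul R a m) = g (tmul R a m)) : f = g := by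
  refine DFunLike.ext _ _ fun t => ?_
  induction t using tensor_induction with
  | zero => simp
  | tmul a m => exact h a m
  | add s t hs ht => simp [hs, ht]

theorem lmap_map (h : M →ₗ[R] N) (f : A →ₗ[Rᵐᵒᵖ] B) (t : Tensor R A M) :
    lmap B h (Tensor.map R M f t) = Tensor.map R N f (lmap A h t) := by
  induction t using tensor_induction with
  | zero => simp
  | tmul a m => simp
  | add s t hs ht => simp only [map_add, hs, ht]

theorem lmap_surjective {h : M →ₗ[R] N} (hh : Function.Surjective h) :
    Function.Surjective (lmap A h) := by
  intro t
  induction t using tensor_induction with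
  | zero => exact ⟨0, map_zero _⟩
  | tmul a n => obtain ⟨m, rfl⟩ := hh n; exact ⟨tmul R a m, rfl⟩
  | add s t hs ht =>
    obtain ⟨x, rfl⟩ := hs
    obtain ⟨y, rfl⟩ := ht
    exact ⟨x + y, map_add _ _ _⟩

theorem lmap_lmap {L : Type u} [AddCommGroup L] [Module R L] (h : M →ₗ[R] N) (k : N →ₗ[R] L)
    (t : Tensor R A M) : lmap A k (lmap A h t) = lmap A (k ∘ₗ h) t := by
  induction t using tensor_induction with
  | zero => simp
  | tmul a m => simp
  | add s t hs ht => simp only [map_add, hs, ht]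

theorem lmap_zero (t : Tensor R A M) : lmap A (0 : M →ₗ[R] N) t = 0 :=
  DFunLike.congr_fun (tensor_hom_ext (g := 0) fun a m => by simp) t

theorem map_exact_zero {f : A →ₗ[Rᵐᵒᵖ] B} {g : B →ₗ[Rᵐᵒᵖ] C} (h : Function.Exact f g)
    (t : Tensor R A M) : Tensor.map R M g (Tensor.map R M f t) = 0 := by
  induction t using tensor_induction with
  | zero => simp
  | tmul a m => simp [h.apply_apply_eq_zero]
  | add s t hs ht => simp only [map_add, hs, ht, add_zero]

variable (A) in
/-- `A ⊗ R` is `A`. -/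
def tensorSelf : Tensor R A R →+ A :=
  tensorLift ((AddMonoidHom.mk' (fun a : A => AddMonoidHom.mk' (fun r : R => MulOpposite.op r • a)
    fun r s => by simp [add_smul]) fun a b => by ext r; simp))
    fun a r s => by simp [mul_smul]

@[simp] theorem tensorSelf_tmul (a : A) (r : R) :
    tensorSelf A (tmul R a r) = MulOpposite.op r • a := rfl

theorem tmul_tensorSelf (t : Tensor R A R) : tmul R (tensorSelf A t) 1 = t := by
  induction t using tensor_induction with
  | zero => simp
  | tmul a r => simp [op_smul_tmul]
  | add s t hs ht => simp only [map_add, add_tmul, hs, ht]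

theorem tensorSelf_map (f : A →ₗ[Rᵐᵒᵖ] B) (t : Tensor R A R) :
    tensorSelf B (Tensor.map R R f t) = f (tensorSelf A t) := by
  induction t using tensor_induction with
  | zero => simp
  | tmul a r => simp
  | add s t hs ht => simp only [map_add, hs, ht]

variable (R A M) in
/-- The components of an element of `A ⊗ (ι →₀ M)`. -/
noncomputable def tensorComponent {ι : Type u} (i : ι) : Tensor R A (ι →₀ M) →+ Tensor R A M :=
  lmap A (Finsupp.lapply i)

/-- A tensor is the sum of its components over any large enough finite index set, so two tensors can
be compared over a common one. -/
theorem tensor_eq_of_component {ι : Type u} {t t' : Tensor R A (ι →₀ M)}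
    (h : ∀ i, tensorComponent R A M i t = tensorComponent R A M i t') : t = t' := by
  classical
  have key : ∀ t : Tensor R A (ι →₀ M), ∃ s : Finset ι, ∀ s', s ⊆ s' →
      t = ∑ i ∈ s', lmap A (Finsupp.lsingle i) (tensorComponent R A M i t) := by
    intro t
    induction t using tensor_induction with
    | zero => exact ⟨∅, by simp⟩
    | tmul a m =>
      refine ⟨m.support, fun s' hs' => ?_⟩
      simp only [tensorComponent, lmap_tmul, ← tmul_sum]
      congr 1
      simpa [Finsupp.sum] using (Finsupp.sum_of_support_subset m hs' (fun i x => Finsupp.single i x)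
        (by simp)).symm.trans m.sum_single |>.symm
    | add x y hx hy =>
      obtain ⟨s, hs⟩ := hx
      obtain ⟨t, ht⟩ := hy
      refine ⟨s ∪ t, fun s' hs' => ?_⟩
      simp only [map_add, Finset.sum_add_distrib]
      rw [← hs s' (Finset.union_subset_left hs'), ← ht s' (Finset.union_subset_right hs')]
  obtain ⟨s, hs⟩ := key t
  obtain ⟨s', hs'⟩ := key t'
  rw [hs (s ∪ s') Finset.subset_union_left, hs' (s ∪ s') Finset.subset_union_right]
  simp only [h]

end Defs

/-! ### Flat modules and the equational criterion -/

section Flat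

variable {M N : Type u} [AddCommGroup M] [Module R M] [AddCommGroup N] [Module R N]

variable (R) in
theorem isFlat_self : IsFlat R R := by
  intro A B C _ _ _ _ _ _ f g h t
  refine ⟨fun ht => ?_, ?_⟩
  · have h1 : g (tensorSelf B t) = 0 := by rw [← tensorSelf_map, ht, map_zero]
    obtain ⟨a, ha⟩ := (h _).1 h1
    exact ⟨tmul R a 1, by rw [map_tmul, ha, tmul_tensorSelf]⟩
  · rintro ⟨t, rfl⟩
    exact map_exact_zero h t

theorem IsFlat.finsupp (hM : IsFlat R M) (ι : Type u) : IsFlat R (ι →₀ M) := by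
  classical
  intro A B C _ _ _ _ _ _ f g h t
  refine ⟨fun ht => ?_, ?_⟩
  · have h1 : ∀ i, ∃ a, Tensor.map R M f a = tensorComponent R B M i t := fun i =>
      (hM A B C f g h _).1 (by
        rw [tensorComponent, ← lmap_map, ht, map_zero])
    choose a ha using h1
    have key : ∀ t : Tensor R B (ι →₀ M), ∃ s : Finset ι, ∀ i ∉ s, tensorComponent R B M i t = 0 := by
      intro t
      induction t using tensor_induction with
      | zero => exact ⟨∅, by simp⟩
      | tmul a m =>
        refine ⟨m.support, fun i hi => ?_⟩
        rw [Finsupp.notMem_support_iff] at hi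
        simp [tensorComponent, hi]
      | add x y hx hy =>
        obtain ⟨s, hs⟩ := hx
        obtain ⟨t, ht⟩ := hy
        refine ⟨s ∪ t, fun i hi => ?_⟩
        rw [Finset.mem_union, not_or] at hi
        rw [map_add, hs i hi.1, ht i hi.2, add_zero]
    obtain ⟨s, hs⟩ := key t
    refine ⟨∑ i ∈ s, lmap A (Finsupp.lsingle i) (a i), tensor_eq_of_component fun j => ?_⟩
    rw [map_sum, map_sum]
    simp only [← lmap_map, ha, tensorComponent, lmap_lmap]
    by_cases hj : j ∈ s
    · rw [Finset.sum_eq_single_of_mem j hj]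
      · congr 1
        congr 1
        ext m
        simp
      · intro i _ hij
        have : (Finsupp.lapply j : (ι →₀ M) →ₗ[R] M) ∘ₗ Finsupp.lsingle i ∘ₗ Finsupp.lapply i = 0 := by
          ext k m
          simp [Finsupp.single_eq_of_ne hij.symm]
        rw [this, lmap_zero]
    · have := hs j hj
      rw [tensorComponent] at this
      rw [this]
      refine Finset.sum_eq_zero fun i hi => ?_
      have hij : i ≠ j := by rintro rfl; exact hj hi
      have : (Finsupp.lapply j : (ι →₀ M) →ₗ[R] M) ∘ₗ Finsupp.lsingle i ∘ₗ Finsupp.lapply i = 0 := by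
        ext k m
        simp [Finsupp.single_eq_of_ne hij.symm]
      rw [this, lmap_zero]
  · rintro ⟨t, rfl⟩
    exact map_exact_zero h t

/-- A quotient `N` of a flat module `M` is flat if the identity of `N` lifts to endomorphisms
`s n` of `M` such that every element of the kernel is eventually killed by them. -/
theorem IsFlat.of_eventually_zero (hM : IsFlat R M) (p : M →ₗ[R] N) (hp : Function.Surjective p)
    (s : ℕ → M →ₗ[R] M) (hps : ∀ n, p ∘ₗ s n = p)
    (hs : ∀ m, p m = 0 → ∃ n, ∀ k, n ≤ k → s k m = 0) : IsFlat R N := by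
  have key : ∀ (C : Type u) [AddCommGroup C] [Module Rᵐᵒᵖ C] (t : Tensor R C M),
      lmap C p t = 0 → ∃ n, lmap C (s n) t = 0 := by
    intro C _ _ t ht
    -- `Z` consists of the tensors eventually killed by the `s k`. Modulo `Z` a tensor depends only
    -- on its image in `C ⊗ N`: `Φ` recovers its class from arbitrary preimages under `p`.
    let Z : AddSubgroup (Tensor R C M) :=
      { carrier := {t | ∃ n, ∀ k, n ≤ k → lmap C (s k) t = 0}
        zero_mem' := ⟨0, fun k _ => map_zero _⟩
        add_mem' := by
          rintro x y ⟨n, hn⟩ ⟨m, hm⟩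
          refine ⟨max n m, fun k hk => ?_⟩
          rw [map_add, hn k (by omega), hm k (by omega), add_zero]
        neg_mem' := by
          rintro x ⟨n, hn⟩
          exact ⟨n, fun k hk => by rw [map_neg, hn k hk, neg_zero]⟩ }
    have hZ : ∀ (c : C) (m m' : M), p m = p m' →
        (QuotientAddGroup.mk (tmul R c m) : Tensor R C M ⧸ Z) = QuotientAddGroup.mk (tmul R c m') := by
      intro c m m' h
      obtain ⟨n, hn⟩ := hs (m - m') (by rw [map_sub, h, sub_self])
      refine QuotientAddGroup.eq_iff_sub_mem.2 ⟨n, fun k hk => ?_⟩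
      have h2 := hn k hk
      rw [map_sub, sub_eq_zero] at h2
      rw [map_sub, lmap_tmul, lmap_tmul, h2, sub_self]
    let q := Function.surjInv hp
    have hq : ∀ x, p (q x) = x := Function.surjInv_eq hp
    let Φ : Tensor R C N →+ Tensor R C M ⧸ Z := tensorLift
      (AddMonoidHom.mk' (fun c => AddMonoidHom.mk' (fun x => QuotientAddGroup.mk (tmul R c (q x)))
        (fun x y => by
          rw [← QuotientAddGroup.mk_add, ← tmul_add]
          exact hZ _ _ _ (by simp [hq])))
        (fun c d => by ext x; simp [add_tmul]))
      (fun c r x => by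
        simp only [AddMonoidHom.mk'_apply, op_smul_tmul]
        exact hZ _ _ _ (by simp [hq]))
    have hΦ : Φ.comp (lmap C p) = QuotientAddGroup.mk' Z :=
      tensor_hom_ext fun c m => hZ _ _ _ (by simp [hq])
    have h1 : (QuotientAddGroup.mk' Z) t = 0 := by
      rw [← hΦ, AddMonoidHom.comp_apply, ht, map_zero]
    obtain ⟨n, hn⟩ := (QuotientAddGroup.eq_zero_iff _).1 h1
    exact ⟨n, hn n le_rfl⟩
  intro A B C _ _ _ _ _ _ f g h t
  refine ⟨fun ht => ?_, ?_⟩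
  · obtain ⟨t, rfl⟩ := lmap_surjective hp t
    rw [← lmap_map] at ht
    obtain ⟨n, hn⟩ := key C _ ht
    rw [lmap_map] at hn
    obtain ⟨w, hw⟩ := (hM A B C f g h _).1 hn
    refine ⟨lmap A p w, ?_⟩
    rw [← lmap_map, hw, lmap_lmap, hps]
  · rintro ⟨t, rfl⟩
    exact map_exact_zero h t

theorem IsFlat.of_retract (hM : IsFlat R M) (p : M →ₗ[R] N) (i : N →ₗ[R] M)
    (h : p ∘ₗ i = LinearMap.id) : IsFlat R N := by
  have h' : ∀ x, p (i x) = x := fun x => DFunLike.congr_fun h x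
  refine hM.of_eventually_zero p (fun x => ⟨i x, h' x⟩) (fun _ => i ∘ₗ p) (fun _ => ?_) ?_
  · ext x; simp [h']
  · intro m hm
    exact ⟨0, fun _ _ => by simp [hm]⟩

theorem IsFlat.of_projective [Module.Projective R M] : IsFlat R M := by
  obtain ⟨i, hi⟩ := Module.projective_def'.1 ‹Module.Projective R M›
  exact ((isFlat_self R).finsupp M).of_retract _ i hi

/-- The equational criterion: relations in a flat module are consequences of relations in the
ring. -/
theorem IsFlat.exists_of_sum_smul_eq_zero (hM : IsFlat R M) {ι : Type u} [Fintype ι] (r : ι → R)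
    (x : ι → M) (h : ∑ i, r i • x i = 0) :
    ∃ (m : ℕ) (a : ι → Fin m → R) (y : Fin m → M), (∀ i, x i = ∑ j, a i j • y j) ∧
      ∀ j, ∑ i, r i * a i j = 0 := by
  classical
  -- Flatness is applied to `ker g → R^ι → R`. The tensor `∑ eᵢ ⊗ xᵢ` dies in `R ⊗ M`, so it comes
  -- from `ker g ⊗ M`, and the vectors of `ker g` that occur are the columns of `a`.
  let g : (ι → R) →ₗ[Rᵐᵒᵖ] R :=
    { toFun := fun v => ∑ i, r i * v i
      map_add' := fun v w => by simp [mul_add, Finset.sum_add_distrib]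
      map_smul' := fun s v => by simp [Finset.sum_mul, mul_assoc] }
  let t : Tensor R (ι → R) M := ∑ i, tmul R (Pi.single i 1) (x i)
  have ht : Tensor.map R M g t = 0 := by
    simp only [t, map_sum, map_tmul]
    have : ∀ i, tmul R (g (Pi.single i 1)) (x i) = tmul R (1 : R) (r i • x i) := by
      intro i
      rw [← op_smul_tmul]
      congr 1
      simp [g, Pi.single_apply]
    simp only [this, ← tmul_sum, h, tmul_zero]
  obtain ⟨w, hw⟩ := (hM (LinearMap.ker g) _ _ (LinearMap.ker g).subtype g
    (LinearMap.exact_subtype_ker_map g) t).1 ht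
  have key : ∀ w : Tensor R (LinearMap.ker g) M, ∃ (m : ℕ) (a : Fin m → LinearMap.ker g)
      (y : Fin m → M), w = ∑ j, tmul R (a j) (y j) := by
    intro w
    induction w using tensor_induction with
    | zero => exact ⟨0, Fin.elim0, Fin.elim0, by simp⟩
    | tmul a m => exact ⟨1, fun _ => a, fun _ => m, by simp⟩
    | add s t hs ht =>
      obtain ⟨m, a, y, rfl⟩ := hs
      obtain ⟨n, b, z, rfl⟩ := ht
      exact ⟨m + n, Fin.append a b, Fin.append y z, by simp [Fin.sum_univ_add]⟩
  obtain ⟨m, a, y, rfl⟩ := key w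
  refine ⟨m, fun i j => (a j : ι → R) i, y, fun i => ?_, fun j => (a j).2⟩
  let ev : Tensor R (ι → R) M →+ M := tensorLift
    (AddMonoidHom.mk' (fun v => AddMonoidHom.mk' (fun x => v i • x) fun x y => smul_add _ _ _)
      fun v w => by ext x; simp [add_smul])
    (fun v s x => by simp [mul_smul])
  have h1 : ev t = x i := by
    simp only [t, map_sum]
    rw [Finset.sum_eq_single i]
    · simp [ev]
    · intro j _ hj
      simp [ev, Pi.single_eq_of_ne hj.symm]
    · simp
  rw [← h1, ← hw]
  simp [map_sum, ev]

end Flat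

end TensorBasics

/-! ### Local progenerators and the structure of flat modules -/

section LocalIdempotent

variable {R : Type u} [Ring R]

theorem mem_jacobson_iff {x : R} : x ∈ Ring.jacobson R ↔ ∀ y, ∃ z, z * (1 - y * x) = 1 := by
  have : Ring.jacobson R = Ideal.jacobson ⊥ := by
    rw [Ring.jacobson_eq_sInf_isMaximal, Ideal.jacobson]
    simp
  rw [this, Ideal.mem_jacobson_iff]
  constructor
  · intro h y
    obtain ⟨z, hz⟩ := h (-y)
    refine ⟨z, ?_⟩
    rw [Ideal.mem_bot] at hz
    rw [← sub_eq_zero, ← hz]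
    noncomm_ring
  · intro h y
    obtain ⟨z, hz⟩ := h (-y)
    refine ⟨z, ?_⟩
    rw [Ideal.mem_bot, ← sub_eq_zero.2 hz]
    noncomm_ring

theorem isUnit_one_sub_of_mem_jacobson {x : R} (hx : x ∈ Ring.jacobson R) : IsUnit (1 - x) := by
  obtain ⟨z, hz⟩ := mem_jacobson_iff.1 hx 1
  rw [one_mul] at hz
  -- The left inverse `z` has again the form `1 - y * x`, so it is left invertible too.
  have h1 : z = 1 - (-z) * x := by linear_combination (norm := noncomm_ring) hz
  obtain ⟨w, hw⟩ := mem_jacobson_iff.1 hx (-z)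
  rw [← h1] at hw
  have hw' : w = 1 - x := by
    calc w = w * (z * (1 - x)) := by rw [hz, mul_one]
      _ = 1 - x := by rw [← mul_assoc, hw, one_mul]
  exact ⟨⟨1 - x, z, by rw [← hw', hw], hz⟩, rfl⟩

/-- An idempotent `e` is a local progenerator if it generates `R` as a two-sided ideal and the
corner `e R e` is local with left T-nilpotent maximal ideal `e J(R) e`. -/
structure IsLocalProgenerator (e : R) : Prop where
  mul_self : e * e = e
  ne_zero : e ≠ 0
  full : Ideal.span (Set.range fun b : R => e * b) = ⊤
  mem_or_exists_inv : ∀ a, e * a * e ∈ Ring.jacobson R ∨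
    ∃ b, e * b * e * (e * a * e) = e ∧ e * a * e * (e * b * e) = e
  nilpotent : ∀ a : ℕ → R, (∀ i, a i ∈ Ring.jacobson R) → (∀ i, e * a i * e = a i) →
    ∃ n : ℕ, ((List.range n).map a).prod = 0

/-- Gaussian elimination: `1 - d k k` is a unit, so `r k` can be solved for and substituted, and the
new coefficients stay in the radical. -/
theorem eq_zero_of_eq_sum_mul_jacobson {ι : Type*} (s : Finset ι) :
    ∀ (r : ι → R) (d : ι → ι → R), (∀ i ∈ s, ∀ l ∈ s, d i l ∈ Ring.jacobson R) →
      (∀ l ∈ s, r l = ∑ i ∈ s, r i * d i l) → ∀ l ∈ s, r l = 0 := by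
  classical
  induction s using Finset.induction_on with
  | empty => simp
  | insert k s hk ih =>
    intro r d hd h
    obtain ⟨u, hu⟩ := isUnit_one_sub_of_mem_jacobson
      (hd k (Finset.mem_insert_self k s) k (Finset.mem_insert_self k s))
    have h1 : r k = ∑ i ∈ s, r i * (d i k * (↑u⁻¹ : R)) := by
      have h2 := h k (Finset.mem_insert_self k s)
      rw [Finset.sum_insert hk] at h2
      have h3 : r k * u = ∑ i ∈ s, r i * d i k := by
        rw [hu, mul_sub, mul_one, sub_eq_iff_eq_add']
        exact h2
      calc r k = r k * u * (↑u⁻¹ : R) := by rw [mul_assoc, Units.mul_inv, mul_one]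
        _ = _ := by rw [h3, Finset.sum_mul]; simp only [mul_assoc]
    have h4 := ih r (fun i l => d i l + d i k * (↑u⁻¹ : R) * d k l) (fun i hi l hl =>
      add_mem (hd i (Finset.mem_insert_of_mem hi) l (Finset.mem_insert_of_mem hl))
        (Ideal.mul_mem_left _ _ (hd k (Finset.mem_insert_self k s) l (Finset.mem_insert_of_mem hl))))
      (fun l hl => by
        conv_lhs => rw [h l (Finset.mem_insert_of_mem hl), Finset.sum_insert hk, h1]
        rw [Finset.sum_mul, ← Finset.sum_add_distrib]
        refine Finset.sum_congr rfl fun i _ => ?_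
        noncomm_ring)
    intro l hl
    rcases Finset.mem_insert.1 hl with rfl | hl
    · rw [h1]
      exact Finset.sum_eq_zero fun i hi => by rw [h4 i hi, zero_mul]
    · exact h4 l hl

/-- Linear independence of elements of `e M` modulo `J M` over the corner `e R e`. -/
def IndepMod {M : Type u} [AddCommGroup M] [Module R M] (e : R) (X : Set M) : Prop :=
  ∀ (s : Finset M) (r : M → R), ↑s ⊆ X → (∀ x ∈ s, e * r x * e = r x) →
    ∑ x ∈ s, r x • x ∈ Ring.jacobson R • (⊤ : Submodule R M) → ∀ x ∈ s, r x ∈ Ring.jacobson R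

namespace IsLocalProgenerator

variable {e : R} (he : IsLocalProgenerator e)
variable {M : Type u} [AddCommGroup M] [Module R M]

include he

theorem notMem_jacobson : e ∉ Ring.jacobson R := by
  intro h
  have := (isUnit_one_sub_of_mem_jacobson h).mul_left_eq_zero.1
    (show e * (1 - e) = 0 by rw [mul_sub, mul_one, he.mul_self, sub_self])
  exact he.ne_zero this

theorem eq_top_of_forall_smul_mem (N : Submodule R M) (h : ∀ x : M, e • x ∈ N) : N = ⊤ := by
  refine eq_top_iff.2 fun x _ => ?_
  have h1 : Ideal.span (Set.range fun b : R => e * b) ≤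
      N.comap (LinearMap.toSpanSingleton R M x) := by
    refine Ideal.span_le.2 ?_
    rintro _ ⟨b, rfl⟩
    simpa [mul_smul] using h (b • x)
  have h2 := h1 (he.full ▸ Submodule.mem_top : (1 : R) ∈ _)
  simpa using h2

/-- Nakayama's lemma for modules that need not be finitely generated. -/
theorem eq_top_of_sup_jacobson_smul (N : Submodule R M)
    (h : N ⊔ Ring.jacobson R • ⊤ = ⊤) : N = ⊤ := by
  classical
  by_contra hN
  have hQ : Ring.jacobson R • (⊤ : Submodule R (M ⧸ N)) = ⊤ := by
    have h1 := congrArg (Submodule.map N.mkQ) h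
    rw [Submodule.map_sup, Submodule.map_smul'', Submodule.map_top, Submodule.range_mkQ,
      Submodule.mkQ_map_self, bot_sup_eq] at h1
    exact h1
  set Q := M ⧸ N
  -- Since `Q = J Q` and `R e R = R`, `p e Q` lies in the span of the `p (e J e) e Q`, so a nonzero
  -- `p e Q` survives multiplication of `p` by some element of `e J e`. Iterating contradicts
  -- T-nilpotency.
  have step : ∀ p : R, (∃ q : Q, p • e • q ≠ 0) → ∃ a ∈ Ring.jacobson R, e * a * e = a ∧
      ∃ q : Q, (p * a) • e • q ≠ 0 := by
    rintro p ⟨q, hq⟩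
    by_contra! hcon
    have key : ∀ x : Q, ∀ a ∈ Ring.jacobson R, (p * e * a) • x = 0 := by
      intro x a ha
      have h2 : (1 : R) ∈ Ideal.span (Set.range fun b : R => e * b) := he.full ▸ Submodule.mem_top
      have h3 : ∀ c ∈ Ideal.span (Set.range fun b : R => e * b), ∀ a ∈ Ring.jacobson R,
          (p * e * a * c) • x = 0 := by
        intro c hc
        induction hc using Submodule.span_induction with
        | mem c hc =>
          obtain ⟨b, rfl⟩ := hc
          intro a ha
          have := hcon (e * a * e) (Ideal.mul_mem_right _ _ (Ideal.mul_mem_left _ _ ha))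
            (by simp only [← mul_assoc, he.mul_self]; rw [mul_assoc _ e e, he.mul_self]) (b • x)
          rw [← this, ← mul_smul, ← mul_smul]
          congr 1
          simp only [mul_assoc]
          rw [← mul_assoc e e, he.mul_self]
        | zero => intro a _; simp
        | add c d _ _ hc hd => intro a ha; rw [mul_add, add_smul, hc a ha, hd a ha, add_zero]
        | smul r c _ hc =>
          intro a ha
          rw [smul_eq_mul, ← mul_assoc, mul_assoc (p * e)]
          exact hc _ (Ideal.mul_mem_right _ _ ha)
      simpa using h3 1 h2 a ha
    have h4 : ∀ x ∈ Ring.jacobson R • (⊤ : Submodule R Q), (p * e) • x = 0 := by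
      intro x hx
      refine Submodule.smul_induction_on hx (fun a ha x _ => ?_) fun x y hx hy => ?_
      · rw [← mul_smul, key x a ha]
      · rw [smul_add, hx, hy, add_zero]
    exact hq (by rw [← mul_smul]; exact h4 q (by rw [hQ]; exact Submodule.mem_top))
  have h0 : ∃ q : Q, (1 : R) • e • q ≠ 0 := by
    by_contra! hcon
    have := he.eq_top_of_forall_smul_mem (⊥ : Submodule R Q) (by simpa using hcon)
    refine hN ?_
    rw [← Submodule.Quotient.subsingleton_iff]
    exact (Submodule.subsingleton_iff R).1 (subsingleton_of_bot_eq_top this)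
  choose f hf using step
  let p : ℕ → {p : R // ∃ q : Q, p • e • q ≠ 0} := fun n =>
    Nat.rec ⟨1, h0⟩ (fun _ p => ⟨p.1 * f p.1 p.2, (hf p.1 p.2).2.2⟩) n
  obtain ⟨n, hn⟩ := he.nilpotent (fun n => f (p n).1 (p n).2) (fun i => (hf _ _).1)
    (fun i => (hf _ _).2.1)
  have hp : ∀ n, ((List.range n).map fun n => f (p n).1 (p n).2).prod = (p n).1 := by
    intro n
    induction n with
    | zero => simp [p]
    | succ n ih => rw [List.prod_range_succ, ih]
  obtain ⟨q, hq⟩ := (p n).2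
  rw [← hp, hn, zero_smul] at hq
  exact hq rfl

/-- Zorn's lemma gives a maximal independent `X`. In a relation that prevents adding `y ∈ e M`, the
coefficient of `y` cannot lie in `J`, so it is invertible in the corner and `y ∈ span X + J M`.
Nakayama's lemma removes `J M`. -/
theorem exists_indepMod_span_eq_top (M : Type u) [AddCommGroup M] [Module R M] :
    ∃ X : Set M, (∀ x ∈ X, e • x = x) ∧ IndepMod e X ∧ Submodule.span R X = ⊤ := by
  classical
  obtain ⟨X, hX⟩ := zorn_subset {X : Set M | (∀ x ∈ X, e • x = x) ∧ IndepMod e X} (by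
    intro c hc hchain
    refine ⟨⋃₀ c, ⟨?_, ?_⟩, fun s hs => Set.subset_sUnion_of_mem hs⟩
    · rintro x ⟨Y, hY, hx⟩
      exact (hc hY).1 x hx
    · intro s r hs
      rcases c.eq_empty_or_nonempty with rfl | hne
      · simp only [Set.sUnion_empty, Set.subset_empty_iff, Finset.coe_eq_empty] at hs
        simp [hs]
      · obtain ⟨Y, hY, hsY⟩ := DirectedOn.exists_mem_subset_of_finset_subset_biUnion
          (f := id) hne (hchain.directedOn) (by simpa [Set.sUnion_eq_biUnion] using hs)
        exact (hc hY).2 s r hsY)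
  refine ⟨X, hX.prop.1, hX.prop.2, he.eq_top_of_sup_jacobson_smul _
    (he.eq_top_of_forall_smul_mem _ fun z => ?_)⟩
  set y := e • z with hy
  have hey : e • y = y := by rw [hy, ← mul_smul, he.mul_self]
  by_cases hyX : y ∈ X
  · exact Submodule.mem_sup_left (Submodule.subset_span hyX)
  have hnot : ¬ IndepMod e (insert y X) := fun h =>
    hyX (hX.le_of_ge (y := insert y X) ⟨by
      rintro x (rfl | hx)
      · exact hey
      · exact hX.prop.1 x hx, h⟩ (Set.subset_insert _ _) (Set.mem_insert _ _))
  simp only [IndepMod, not_forall] at hnot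
  obtain ⟨s, r, hs, hr, hsum, x, hxs, hx⟩ := hnot
  have hsX : ∀ w ∈ s.erase y, w ∈ X := fun w hw =>
    (hs (Finset.mem_of_mem_erase hw)).resolve_left (Finset.ne_of_mem_erase hw)
  have hys : y ∈ s := by
    by_contra hys
    exact hx (hX.prop.2 s r (fun w hw => (hs hw).resolve_left (fun h => hys (h ▸ hw))) hr hsum x hxs)
  rw [← Finset.add_sum_erase s _ hys] at hsum
  rcases he.mem_or_exists_inv (r y) with h1 | ⟨b, hb, -⟩
  · rw [hr y hys] at h1
    have h2 : ∑ w ∈ s.erase y, r w • w ∈ Ring.jacobson R • (⊤ : Submodule R M) := by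
      have := Submodule.sub_mem _ hsum
        (Submodule.smul_mem_smul h1 (Submodule.mem_top : y ∈ (⊤ : Submodule R M)))
      simpa using this
    have h3 := hX.prop.2 _ r hsX (fun w hw => hr w (Finset.mem_of_mem_erase hw)) h2
    by_cases hxy : x = y
    · exact absurd (hxy ▸ h1) hx
    · exact absurd (h3 x (Finset.mem_erase.2 ⟨hxy, hxs⟩)) hx
  · rw [hr y hys] at hb
    have h2 : y = (e * b * e) • (r y • y + ∑ w ∈ s.erase y, r w • w) -
        (e * b * e) • ∑ w ∈ s.erase y, r w • w := by
      rw [smul_add, add_sub_cancel_right, ← mul_smul, hb, hey]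
    rw [h2]
    refine Submodule.sub_mem _ (Submodule.mem_sup_right (Submodule.smul_mem _ _ hsum))
      (Submodule.mem_sup_left (Submodule.smul_mem _ _ (Submodule.sum_mem _ fun w hw => ?_)))
    exact Submodule.smul_mem _ _ (Submodule.subset_span (hsX w hw))

/-- A flat module is a direct sum of copies of `R e`. -/
theorem exists_linearEquiv_of_isFlat (hM : IsFlat R M) :
    ∃ ι : Type u, Nonempty ((ι →₀ (Ideal.span {e} : Ideal R)) ≃ₗ[R] M) := by
  classical
  obtain ⟨X, hXe, hX, hspan⟩ := he.exists_indepMod_span_eq_top M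
  have hmul : ∀ r : (Ideal.span {e} : Ideal R), (r : R) * e = r := by
    rintro ⟨r, hr⟩
    obtain ⟨b, rfl⟩ := Ideal.mem_span_singleton'.1 hr
    simp [mul_assoc, he.mul_self]
  let Φ : (X →₀ (Ideal.span {e} : Ideal R)) →ₗ[R] M :=
    Finsupp.lsum ℕ fun x : X => (LinearMap.toSpanSingleton R M x.1) ∘ₗ (Ideal.span {e}).subtype
  have hΦ : ∀ f, Φ f = f.sum fun x r => (r : R) • x.1 := fun f => rfl
  refine ⟨X, ⟨LinearEquiv.ofBijective Φ ⟨?_, ?_⟩⟩⟩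
  · rw [← LinearMap.ker_eq_bot, LinearMap.ker_eq_bot']
    intro f hf
    rw [hΦ, Finsupp.sum, ← Finset.sum_coe_sort] at hf
    -- Expanding the `y j` in `X` turns `x i = ∑ a i j • y j` into `x i = ∑ c i l • l` with `c` over
    -- the corner. Independence modulo `J` forces `c ≡ e • 1`, while `f c = 0`; so `f = f (e • 1 -
    -- c)`, and elimination gives `f = 0`.
    obtain ⟨m, a, y, hxy, ha⟩ := hM.exists_of_sum_smul_eq_zero
      (fun i : f.support => (f i.1 : R)) (fun i => i.1.1) hf
    have hy : ∀ z : M, ∃ b : X →₀ R, (b.sum fun x r => r • x.1) = z ∧ ∀ x, b x * e = b x := by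
      intro z
      obtain ⟨c, hc⟩ := (Finsupp.mem_span_iff_linearCombination R X z).1 (hspan ▸ Submodule.mem_top)
      refine ⟨c.mapRange (· * e) (zero_mul e), ?_, fun x => by simp [mul_assoc, he.mul_self]⟩
      rw [Finsupp.sum_mapRange_index (by simp), ← hc, Finsupp.linearCombination_apply]
      refine Finsupp.sum_congr fun x _ => ?_
      rw [mul_smul, hXe x.1 x.2]
    choose b hb hbe using fun j => hy (y j)
    let T : Finset X := f.support ∪ Finset.univ.biUnion fun j => (b j).support
    have hbT : ∀ j, y j = ∑ x ∈ T, b j x • x.1 := by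
      intro j
      rw [← hb j]
      refine Finsupp.sum_of_support_subset _ ?_ _ (by simp)
      exact (Finset.subset_biUnion_of_mem (fun j => (b j).support) (Finset.mem_univ j)).trans
        Finset.subset_union_right
    let c : X → X → R := fun i l => if h : i ∈ f.support then e * ∑ j, a ⟨i, h⟩ j * b j l else 0
    have hc : ∀ i ∈ f.support, i.1 = ∑ l ∈ T, c i l • l.1 := by
      intro i hi
      simp only [c, hi, dite_true]
      conv_lhs => rw [← hXe i.1 i.2, hxy ⟨i, hi⟩]
      simp only [mul_smul, ← Finset.smul_sum, Finset.sum_smul]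
      rw [Finset.sum_comm]
      congr 1
      refine Finset.sum_congr rfl fun j _ => ?_
      rw [← Finset.smul_sum, ← hbT]
    have hcJ : ∀ i ∈ f.support, ∀ l ∈ T, (if i = l then e else 0) - c i l ∈ Ring.jacobson R := by
      intro i hi l hl
      have key := hX (T.map (Function.Embedding.subtype _))
        (fun x => if h : x ∈ X then (if i = ⟨x, h⟩ then e else 0) - c i ⟨x, h⟩ else 0) (by simp)
        (by
          intro x hx
          obtain ⟨l, hl, rfl⟩ := Finset.mem_map.1 hx
          simp only [Function.Embedding.subtype_apply, Subtype.coe_eta, l.2, dite_true]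
          simp only [c, hi, dite_true]
          have h1 : (∑ j, a ⟨i, hi⟩ j * b j l) * e = ∑ j, a ⟨i, hi⟩ j * b j l := by
            rw [Finset.sum_mul]
            exact Finset.sum_congr rfl fun j _ => by rw [mul_assoc, hbe]
          rw [mul_sub, sub_mul, ← mul_assoc, he.mul_self, mul_assoc e (∑ j, _), h1]
          split_ifs <;> simp [he.mul_self])
        (by
          rw [Finset.sum_map]
          simp only [Function.Embedding.subtype_apply, Subtype.coe_eta, Subtype.coe_prop, dite_true]
          simp only [sub_smul, Finset.sum_sub_distrib]
          rw [← hc i hi]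
          have hiT : i ∈ T := Finset.mem_union_left _ hi
          simp [ite_smul, hiT, hXe i.1 i.2])
        l.1 (Finset.mem_map_of_mem _ hl)
      simpa using key
    have hzero := eq_zero_of_eq_sum_mul_jacobson f.support (fun i => (f i : R))
      (fun i l => (if i = l then e else 0) - c i l)
      (fun i hi l hl => hcJ i hi l (Finset.mem_union_left _ hl))
      (by
        intro l hl
        simp only [mul_sub, Finset.sum_sub_distrib, mul_ite, mul_zero]
        rw [Finset.sum_ite_eq' f.support l]
        have : ∑ i ∈ f.support, (f i : R) * c i l = 0 := by
          rw [← Finset.sum_coe_sort]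
          simp only [c, Finset.coe_mem, dite_true]
          have h1 : ∀ i : f.support, (f i.1 : R) * (e * ∑ j, a i j * b j l) =
              ∑ j, (f i.1 : R) * a i j * b j l := by
            intro i
            rw [← mul_assoc, hmul, Finset.mul_sum]
            simp only [mul_assoc]
          simp only [Subtype.coe_eta, h1]
          rw [Finset.sum_comm]
          refine Finset.sum_eq_zero fun j _ => ?_
          rw [← Finset.sum_mul, ha j, zero_mul]
        rw [if_pos hl, hmul, this, sub_zero])
    ext x
    by_cases hx : x ∈ f.support
    · simpa using hzero x hx
    · simpa using hx
  · rw [← LinearMap.range_eq_top, eq_top_iff, ← hspan, Submodule.span_le]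
    intro x hx
    refine ⟨Finsupp.single ⟨x, hx⟩ ⟨e, Ideal.mem_span_singleton_self e⟩, ?_⟩
    rw [hΦ, Finsupp.sum_single_index (by simp)]
    exact hXe x hx

end IsLocalProgenerator

end LocalIdempotent

/-! ### Bass modules -/

section Bass

variable {R : Type u} [Ring R]

/-- The product `a i * a (i + 1) * ⋯ * a (i + n - 1)`. -/
def segProd (a : ℕ → R) (i n : ℕ) : R := ((List.range n).map fun k => a (i + k)).prod

@[simp] theorem segProd_zero (a : ℕ → R) (i : ℕ) : segProd a i 0 = 1 := by simp [segProd]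

theorem segProd_succ (a : ℕ → R) (i n : ℕ) : segProd a i (n + 1) = segProd a i n * a (i + n) := by
  rw [segProd, List.prod_range_succ, segProd]

theorem segProd_succ' (a : ℕ → R) (i n : ℕ) :
    segProd a i (n + 1) = a i * segProd a (i + 1) n := by
  induction n with
  | zero => simp [segProd_succ]
  | succ n ih =>
    rw [segProd_succ, ih, segProd_succ, mul_assoc, add_right_comm i 1 n, add_assoc i n 1]

/-- The relations `x n = a n • x (n + 1)` of the Bass module. -/
noncomputable def bassRel (a : ℕ → R) : Submodule R (ℕ →₀ R) :=
  Submodule.span R (Set.range fun n => Finsupp.single n 1 - a n • Finsupp.single (n + 1) 1)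

/-- The Bass module of a sequence `a`: the colimit of `R → R → ⋯`, the maps being the right
multiplications by the `a n`. -/
abbrev Bass (a : ℕ → R) : Type u := (ℕ →₀ R) ⧸ bassRel a

/-- The generators of the Bass module. -/
noncomputable def bassGen (a : ℕ → R) (n : ℕ) : Bass a := (bassRel a).mkQ (Finsupp.single n 1)

theorem bassGen_eq_smul_succ (a : ℕ → R) (n : ℕ) : bassGen a n = a n • bassGen a (n + 1) := by
  rw [bassGen, bassGen, ← map_smul, ← sub_eq_zero, ← map_sub, Submodule.mkQ_apply,
    Submodule.Quotient.mk_eq_zero]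
  exact Submodule.subset_span ⟨n, rfl⟩

theorem bassGen_eq_segProd_smul (a : ℕ → R) (n k : ℕ) :
    bassGen a n = segProd a n k • bassGen a (n + k) := by
  induction k with
  | zero => simp
  | succ k ih => rw [ih, segProd_succ, mul_smul, add_assoc n k 1 |>.symm, ← bassGen_eq_smul_succ]

/-- The endomorphism of the free module moving the first `N` generators to the `N`-th one. -/
noncomputable def bassShift (a : ℕ → R) (N : ℕ) : (ℕ →₀ R) →ₗ[R] (ℕ →₀ R) :=
  Finsupp.linearCombination R fun i =>
    if i ≤ N then segProd a i (N - i) • Finsupp.single N 1 else Finsupp.single i 1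

theorem bassShift_single (a : ℕ → R) {N i : ℕ} (h : i ≤ N) :
    bassShift a N (Finsupp.single i 1) = segProd a i (N - i) • Finsupp.single N 1 := by
  simp [bassShift, h]

theorem mkQ_comp_bassShift (a : ℕ → R) (N : ℕ) :
    (bassRel a).mkQ ∘ₗ bassShift a N = (bassRel a).mkQ := by
  refine Finsupp.lhom_ext' fun i => LinearMap.ext_ring ?_
  by_cases h : i ≤ N
  · simp only [LinearMap.comp_apply, Finsupp.lsingle_apply, bassShift_single a h, map_smul]
    have := bassGen_eq_segProd_smul a i (N - i)
    rw [Nat.add_sub_cancel' h] at this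
    exact this.symm
  · simp [bassShift, h]

/-- Once `k > n`, generator `n` and `a n` times generator `n + 1` are moved to the same multiple of
generator `k`. -/
theorem bassShift_eventually_zero (a : ℕ → R) (m : ℕ →₀ R) (hm : m ∈ bassRel a) :
    ∃ n, ∀ k, n ≤ k → bassShift a k m = 0 := by
  induction hm using Submodule.span_induction with
  | mem x hx =>
    obtain ⟨n, rfl⟩ := hx
    refine ⟨n + 1, fun k hk => ?_⟩
    obtain ⟨d, rfl⟩ := Nat.exists_eq_add_of_le hk
    rw [map_sub, map_smul, bassShift_single a (by omega), bassShift_single a (by omega),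
      ← mul_smul, ← segProd_succ', sub_eq_zero]
    congr 2
    omega
  | zero => exact ⟨0, fun k _ => map_zero _⟩
  | add x y _ _ hx hy =>
    obtain ⟨n, hn⟩ := hx
    obtain ⟨m, hm⟩ := hy
    exact ⟨max n m, fun k hk => by rw [map_add, hn k (by omega), hm k (by omega), add_zero]⟩
  | smul r x _ hx =>
    obtain ⟨n, hn⟩ := hx
    exact ⟨n, fun k hk => by rw [map_smul, hn k hk, smul_zero]⟩

theorem isFlat_bass (a : ℕ → R) : IsFlat R (Bass a) :=
  (IsFlat.of_projective (R := R) (M := ℕ →₀ R)).of_eventually_zero (bassRel a).mkQ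
    (Submodule.mkQ_surjective _) (bassShift a) (mkQ_comp_bassShift a)
    fun m hm => bassShift_eventually_zero a m (by simpa using hm)

theorem bass_countably_generated (a : ℕ → R) :
    ∃ s : Set (Bass a), s.Countable ∧ Submodule.span R s = ⊤ := by
  refine ⟨Set.range (bassGen a), Set.countable_range _, ?_⟩
  have h : Set.range (bassGen a) = (bassRel a).mkQ '' Set.range fun n => Finsupp.single n (1 : R) := by
    rw [← Set.range_comp]
    rfl
  rw [h, ← Submodule.map_span]
  have h2 : Submodule.span R (Set.range fun n : ℕ => Finsupp.single n (1 : R)) = ⊤ := by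
    simpa using (Finsupp.basisSingleOne (R := R) (ι := ℕ)).span_eq
  rw [h2, Submodule.map_top, Submodule.range_mkQ]

/-- If the Bass module is projective then the principal right ideals generated by the initial
products become stationary. -/
theorem exists_segProd_eq_mul (a : ℕ → R) [Module.Projective R (Bass a)] :
    ∃ N, ∀ m, ∃ r, segProd a 0 N = segProd a 0 m * r := by
  obtain ⟨i, hi⟩ := Module.projective_lifting_property (bassRel a).mkQ LinearMap.id
    (Submodule.mkQ_surjective _)
  have hi' : ∀ x, (bassRel a).mkQ (i x) = x := fun x => DFunLike.congr_fun hi x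
  obtain ⟨N, hN⟩ := bassShift_eventually_zero a (Finsupp.single 0 1 - i (bassGen a 0)) (by
    refine (Submodule.Quotient.mk_eq_zero _).1 (?_ : (bassRel a).mkQ _ = 0)
    rw [map_sub, hi']
    exact sub_self _)
  -- The `N`-th shift sends generator `0` to `segProd a 0 N` times generator `N`, and it agrees
  -- there on `i (bassGen a 0) = segProd a 0 m • i (bassGen a m)`. The identity is read off at
  -- coordinate `N`.
  refine ⟨N, fun m => ⟨bassShift a N (i (bassGen a m)) N, ?_⟩⟩
  have h1 := hN N le_rfl
  have h2 := bassGen_eq_segProd_smul a 0 m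
  rw [zero_add] at h2
  rw [map_sub, bassShift_single a (Nat.zero_le N), h2, map_smul, map_smul, sub_eq_zero] at h1
  simpa using DFunLike.congr_fun h1 N

end Bass

/-! ### Consequences of the chain condition on principal right ideals -/

section Stationary

variable {R : Type u} [Ring R]

/-- The descending chain condition for principal right ideals. -/
def IsStationary (R : Type u) [Ring R] : Prop :=
  ∀ a : ℕ → R, ∃ N, ∀ m, ∃ r, segProd a 0 N = segProd a 0 m * r

theorem IsStationary.of_forall_projective
    (h : ∀ a : ℕ → R, Module.Projective R (Bass a)) : IsStationary R :=
  fun a => have := h a; exists_segProd_eq_mul a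

theorem eq_zero_of_eq_mul_jacobson {x y : R} (hy : y ∈ Ring.jacobson R) (h : x = x * y) : x = 0 :=
  (isUnit_one_sub_of_mem_jacobson hy).mul_left_eq_zero.1
    (by rw [mul_sub, mul_one, ← h, sub_self])

/-- Stationarity gives `p = p * (a N * r)` for the product `p` of the first `N` terms, and `a N * r`
lies in the radical. -/
theorem IsStationary.exists_prod_eq_zero (h : IsStationary R) (a : ℕ → R)
    (ha : ∀ i, a i ∈ Ring.jacobson R) : ∃ n, ((List.range n).map a).prod = 0 := by
  obtain ⟨N, hN⟩ := h a
  obtain ⟨r, hr⟩ := hN (N + 1)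
  refine ⟨N, ?_⟩
  rw [segProd_succ, zero_add, mul_assoc] at hr
  have := eq_zero_of_eq_mul_jacobson (Ideal.mul_mem_right r _ (ha N)) hr
  simpa [segProd] using this

theorem IsStationary.isNilpotent (h : IsStationary R) {x : R} (hx : x ∈ Ring.jacobson R) :
    IsNilpotent x := by
  obtain ⟨n, hn⟩ := h.exists_prod_eq_zero (fun _ => x) fun _ => hx
  exact ⟨n, by simpa using hn⟩

theorem one_notMem_jacobson [Nontrivial R] : (1 : R) ∉ Ring.jacobson R := fun h =>
  (Ring.jacobson_lt_top R).ne ((Ideal.eq_top_iff_one _).2 h)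

/-- Otherwise right multiples outside `J` could be chosen forever, each generating a strictly
smaller right ideal. -/
theorem IsStationary.exists_minimal [Nontrivial R] (h : IsStationary R) :
    ∃ a ∉ Ring.jacobson R, ∀ r, a * r ∉ Ring.jacobson R → ∃ s, a = a * r * s := by
  by_contra! hcon
  choose f hf hf' using hcon
  let p : ℕ → {a : R // a ∉ Ring.jacobson R} := fun n =>
    Nat.rec ⟨1, one_notMem_jacobson⟩ (fun _ p => ⟨p.1 * f p.1 p.2, hf p.1 p.2⟩) n
  have hp : ∀ n, segProd (fun n => f (p n).1 (p n).2) 0 n = (p n).1 := by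
    intro n
    induction n with
    | zero => simp [p]
    | succ n ih => rw [segProd_succ, ih, zero_add]
  obtain ⟨N, hN⟩ := h fun n => f (p n).1 (p n).2
  obtain ⟨s, hs⟩ := hN (N + 1)
  rw [hp, hp] at hs
  exact hf' _ (p N).2 s hs

/-- `J` is semiprime, by the factorization `1 - (y a)² = (1 + y a) (1 - y a)`. -/
theorem mem_jacobson_of_forall_mul_mul_mem {a : R} (h : ∀ r, a * r * a ∈ Ring.jacobson R) :
    a ∈ Ring.jacobson R := by
  refine mem_jacobson_iff.2 fun y => ?_
  obtain ⟨z, hz⟩ := mem_jacobson_iff.1 (h y) y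
  refine ⟨z * (1 + y * a), ?_⟩
  calc z * (1 + y * a) * (1 - y * a) = z * (1 - y * (a * y * a)) := by noncomm_ring
    _ = 1 := hz

theorem IsStationary.exists_idempotent_lift (h : IsStationary R) {e₀ : R}
    (he₀ : e₀ * e₀ - e₀ ∈ Ring.jacobson R) :
    ∃ e : R, e * e = e ∧ Ideal.Quotient.mk (Ring.jacobson R) e =
      Ideal.Quotient.mk (Ring.jacobson R) e₀ := by
  obtain ⟨e, he, hee⟩ := exists_isIdempotentElem_eq_of_ker_isNilpotent
    (Ideal.Quotient.mk (Ring.jacobson R))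
    (fun x hx => h.isNilpotent (by rwa [Ideal.mk_ker] at hx))
    (Ideal.Quotient.mk (Ring.jacobson R) e₀) ⟨e₀, rfl⟩
    (by
      rw [IsIdempotentElem, ← map_mul]
      exact Ideal.Quotient.eq.2 he₀)
  exact ⟨e, he, hee⟩

/-- Brauer's lemma modulo `J`: a minimal right ideal that does not square to zero is generated by an
idempotent with a division ring as corner. -/
theorem IsStationary.exists_local_idempotent [Nontrivial R] (h : IsStationary R) :
    ∃ e : R, e * e = e ∧ e ∉ Ring.jacobson R ∧ ∀ x, e * x * e ∉ Ring.jacobson R →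
      ∃ y, e * x * e * (e * y * e) - e ∈ Ring.jacobson R := by
  obtain ⟨a, ha, hmin⟩ := h.exists_minimal
  obtain ⟨r, hr⟩ : ∃ r, a * r * a ∉ Ring.jacobson R := by
    by_contra! hcon
    exact ha (mem_jacobson_of_forall_mul_mul_mem hcon)
  obtain ⟨s₀, hs₀⟩ := hmin r fun hc => hr (Ideal.mul_mem_right _ _ hc)
  obtain ⟨s, hs⟩ := hmin (r * (a * r)) fun hc => hr (by
    have := Ideal.mul_mem_right s₀ _ hc
    rwa [← mul_assoc, mul_assoc (a * r), ← hs₀] at this)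
  obtain ⟨c, hc⟩ : ∃ c, c = a * r := ⟨_, rfl⟩
  obtain ⟨t, ht⟩ : ∃ t, t = s * r := ⟨_, rfl⟩
  have hct : c = c * (c * t) := by
    rw [ht, hc]
    conv_lhs => rw [hs]
    simp only [mul_assoc]
  have hcJ : c ∉ Ring.jacobson R := fun hcJ => hr (hc ▸ Ideal.mul_mem_right _ _ hcJ)
  -- Left multiplication by `c = a r` is injective on `c R` modulo `J`: if `c z ∉ J`, minimality
  -- gives `a ∈ c z R`, so `c a = 0`, against `a r a ∉ J`. As `c e₀ = c`, this makes `e₀ = c t`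
  -- idempotent modulo `J`.
  have hK : ∀ z, c * (c * z) = 0 → c * z ∈ Ring.jacobson R := by
    intro z hz
    by_contra hzJ
    obtain ⟨w, hw⟩ := hmin (r * z) (by rwa [← mul_assoc, ← hc])
    rw [← mul_assoc, ← hc] at hw
    refine hr ?_
    rw [← hc, hw, ← mul_assoc, hz, zero_mul]
    exact zero_mem _
  obtain ⟨e₀, he₀⟩ : ∃ e₀, e₀ = c * t := ⟨_, rfl⟩
  rw [← he₀] at hct
  have hidem : e₀ * e₀ - e₀ ∈ Ring.jacobson R := by
    have h1 : e₀ * e₀ - e₀ = c * (t * e₀ - t) := by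
      rw [mul_sub, ← mul_assoc, ← he₀]
    rw [h1]
    refine hK _ ?_
    rw [← h1, mul_sub, ← mul_assoc, ← hct, ← hct, sub_self]
  obtain ⟨e, he, hee⟩ := h.exists_idempotent_lift hidem
  have he₀J : e₀ ∉ Ring.jacobson R := fun h => hcJ (hct ▸ Ideal.mul_mem_left _ c h)
  refine ⟨e, he, fun h => he₀J ?_, fun x hx => ?_⟩
  · rw [← Ideal.Quotient.eq_zero_iff_mem] at h ⊢
    rw [← hee, h]
  · have h1 : e₀ * x * e₀ ∉ Ring.jacobson R := by
      rw [← Ideal.Quotient.eq_zero_iff_mem] at hx ⊢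
      simpa only [map_mul, hee] using hx
    have h2 : e₀ * x * e₀ = a * (r * t * x * e₀) := by
      rw [he₀, hc]; simp only [mul_assoc]
    obtain ⟨w, hw⟩ := hmin _ (h2 ▸ h1)
    rw [← h2] at hw
    have h3 : e₀ * x * e₀ * (w * r * t) = e₀ := by
      conv_rhs => rw [he₀, hc, hw]
      simp only [mul_assoc]
    obtain ⟨y, hy⟩ : ∃ y, y = w * r * t := ⟨_, rfl⟩
    rw [← hy] at h3
    refine ⟨y, ?_⟩
    have h4 := congrArg (Ideal.Quotient.mk (Ring.jacobson R)) h3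
    have h5 := congrArg (Ideal.Quotient.mk (Ring.jacobson R)) he
    rw [← Ideal.Quotient.eq]
    simp only [map_mul, ← hee] at h4 h5 ⊢
    generalize Ideal.Quotient.mk (Ring.jacobson R) e = E at *
    calc _ = E * Ideal.Quotient.mk _ x * (E * E) * Ideal.Quotient.mk _ y * E := by
          simp only [mul_assoc]
      _ = E := by rw [h5, h4, h5]

theorem IsStationary.isLocalProgenerator (h : IsStationary R) {e : R} (he : e * e = e)
    (heJ : e ∉ Ring.jacobson R) (hfull : Ideal.span (Set.range fun b : R => e * b) = ⊤)
    (hinv : ∀ x, e * x * e ∉ Ring.jacobson R →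
      ∃ y, e * x * e * (e * y * e) - e ∈ Ring.jacobson R) : IsLocalProgenerator e := by
  -- The product is `e - j` with `j` in the radical of the corner. The unit `1 - j` commutes with
  -- `e`, so the inverse modulo `J` can be corrected to an exact right inverse. Right inverses for
  -- all elements outside `J` are then two-sided.
  have right : ∀ x, e * x * e ∉ Ring.jacobson R → ∃ z, e * x * e * (e * z * e) = e := by
    intro x hx
    obtain ⟨y, hy⟩ := hinv x hx
    obtain ⟨j, hj⟩ : ∃ j, j = e - e * x * e * (e * y * e) := ⟨_, rfl⟩
    have hjJ : j ∈ Ring.jacobson R := by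
      rw [hj, ← neg_sub]
      exact neg_mem hy
    have hje : j * e = j := by
      rw [hj, sub_mul, he]
      simp only [mul_assoc, he]
    have hej : e * j = j := by
      rw [hj, mul_sub, he]
      simp only [← mul_assoc, he]
    obtain ⟨v, hv⟩ := isUnit_one_sub_of_mem_jacobson hjJ
    have hcomm : Commute e (v : R) := by
      rw [hv, Commute, SemiconjBy, mul_sub, sub_mul, hje, hej, one_mul, mul_one]
    have hw : e * x * e * (e * y * e) = e * v := by
      rw [hv, mul_sub, hej, hj, mul_one, sub_sub_cancel]
    refine ⟨y * e * (↑v⁻¹ : R), ?_⟩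
    have h1 : e * (y * e * (↑v⁻¹ : R)) * e = e * y * e * (↑v⁻¹ * e) := by
      simp only [mul_assoc]
    rw [h1, ← mul_assoc, hw, mul_assoc, Units.mul_inv_cancel_left, he]
  refine ⟨he, fun h0 => heJ (h0 ▸ zero_mem _), hfull, fun x => ?_, fun a ha _ =>
    h.exists_prod_eq_zero a ha⟩
  by_cases hx : e * x * e ∈ Ring.jacobson R
  · exact Or.inl hx
  · right
    obtain ⟨z, hz⟩ := right x hx
    obtain ⟨w, hw⟩ := right z fun h => heJ (hz ▸ Ideal.mul_mem_left _ _ h)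
    refine ⟨z, ?_, hz⟩
    have : e * x * e = e * w * e := by
      calc e * x * e = e * x * e * e := by rw [mul_assoc _ e e, he]
        _ = e * x * e * (e * z * e * (e * w * e)) := by rw [hw]
        _ = e * x * e * (e * z * e) * (e * w * e) := by simp only [mul_assoc]
        _ = e * w * e := by rw [hz]; simp only [← mul_assoc, he]
    rw [this, hw]

end Stationary

/-! ### Passage along isomorphisms and to and from `R / J` -/

section Transport

variable {R S : Type u} [Ring R] [Ring S]

theorem map_mem_jacobson (φ : R ≃+* S) {x : R} (hx : x ∈ Ring.jacobson R) :
    φ x ∈ Ring.jacobson S := by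
  refine mem_jacobson_iff.2 fun y => ?_
  obtain ⟨z, hz⟩ := mem_jacobson_iff.1 hx (φ.symm y)
  exact ⟨φ z, by simpa using congrArg φ hz⟩

theorem span_mul_eq_top_of_surjective (φ : R →+* S) (hφ : Function.Surjective φ) {e : R}
    (h : Ideal.span (Set.range fun b : R => e * b) = ⊤) :
    Ideal.span (Set.range fun b : S => φ e * b) = ⊤ := by
  have h1 : (Set.range fun b : S => φ e * b) = φ '' Set.range fun b : R => e * b := by
    rw [← Set.range_comp]
    ext x
    constructor
    · rintro ⟨b, rfl⟩
      obtain ⟨b, rfl⟩ := hφ b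
      exact ⟨b, map_mul _ _ _⟩
    · rintro ⟨b, rfl⟩
      exact ⟨φ b, (map_mul _ _ _).symm⟩
  rw [h1, ← Ideal.map_span, h, Ideal.map_top]

theorem IsLocalProgenerator.map {e : R} (he : IsLocalProgenerator e) (φ : R ≃+* S) :
    IsLocalProgenerator (φ e) where
  mul_self := by rw [← map_mul, he.mul_self]
  ne_zero := by simpa using he.ne_zero
  full := span_mul_eq_top_of_surjective (φ : R →+* S) φ.surjective he.full
  mem_or_exists_inv a := by
    obtain ⟨a, rfl⟩ := φ.surjective a
    rcases he.mem_or_exists_inv a with h | ⟨b, hb, hb'⟩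
    · exact Or.inl (by simpa using map_mem_jacobson φ h)
    · exact Or.inr ⟨φ b, by simpa using congrArg φ hb, by simpa using congrArg φ hb'⟩
  nilpotent a ha hae := by
    obtain ⟨n, hn⟩ := he.nilpotent (fun i => φ.symm (a i)) (fun i => map_mem_jacobson φ.symm (ha i))
      (fun i => by simpa using congrArg φ.symm (hae i))
    refine ⟨n, ?_⟩
    have := congrArg φ hn
    rw [map_list_prod, List.map_map, map_zero] at this
    simpa [Function.comp_def] using this

theorem IsLocalProgenerator.quotient {e : R} (he : IsLocalProgenerator e) :
    IsLocalProgenerator (Ideal.Quotient.mk (Ring.jacobson R) e) where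
  mul_self := by rw [← map_mul, he.mul_self]
  ne_zero := fun h => he.notMem_jacobson (Ideal.Quotient.eq_zero_iff_mem.1 h)
  full := span_mul_eq_top_of_surjective _ Ideal.Quotient.mk_surjective he.full
  mem_or_exists_inv a := by
    obtain ⟨a, rfl⟩ := Ideal.Quotient.mk_surjective a
    simp only [← map_mul]
    rcases he.mem_or_exists_inv a with h | ⟨b, hb, hb'⟩
    · refine Or.inl ?_
      rw [Ideal.Quotient.eq_zero_iff_mem.2 h]
      exact zero_mem _
    · exact Or.inr ⟨Ideal.Quotient.mk _ b, by simp only [← map_mul, hb],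
        by simp only [← map_mul, hb']⟩
  -- The radical of `R / J` is zero, so one factor suffices.
  nilpotent a ha _ := ⟨1, by simpa using ha 0⟩

/-- Fullness lifts because an element of `R e R` congruent to `1` modulo `J` is a unit. -/
theorem IsStationary.isLocalProgenerator_of_quotient (h : IsStationary R) {e : R} (he : e * e = e)
    (heq : IsLocalProgenerator (Ideal.Quotient.mk (Ring.jacobson R) e)) :
    IsLocalProgenerator e := by
  refine h.isLocalProgenerator he (fun h => heq.ne_zero (Ideal.Quotient.eq_zero_iff_mem.2 h)) ?_ ?_
  · have h1 : (1 : R ⧸ Ring.jacobson R) ∈ Ideal.map (Ideal.Quotient.mk (Ring.jacobson R))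
        (Ideal.span (Set.range fun b : R => e * b)) := by
      rw [Ideal.map_span, ← Set.range_comp]
      have h2 : Ideal.span (Set.range fun b => Ideal.Quotient.mk (Ring.jacobson R) e * b) ≤
          Ideal.span (Set.range (Ideal.Quotient.mk (Ring.jacobson R) ∘ fun b => e * b)) := by
        refine Ideal.span_mono ?_
        rintro _ ⟨b, rfl⟩
        obtain ⟨b, rfl⟩ := Ideal.Quotient.mk_surjective b
        exact ⟨b, map_mul _ _ _⟩
      exact h2 (heq.full ▸ Submodule.mem_top)
    obtain ⟨i, hi, hi1⟩ :=
      (Ideal.mem_map_iff_of_surjective _ Ideal.Quotient.mk_surjective).1 h1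
    have h2 : 1 - i ∈ Ring.jacobson R := by
      rw [← Ideal.Quotient.eq_zero_iff_mem, map_sub, hi1, map_one, sub_self]
    have h3 := isUnit_one_sub_of_mem_jacobson h2
    rw [sub_sub_cancel] at h3
    obtain ⟨v, hv⟩ := h3
    rw [Ideal.eq_top_iff_one, ← v.inv_mul, hv]
    exact Ideal.mul_mem_left _ _ hi
  · intro x hx
    rcases heq.mem_or_exists_inv (Ideal.Quotient.mk _ x) with h1 | ⟨b, -, hb⟩
    · refine absurd ?_ hx
      rw [Ring.jacobson_quotient_jacobson, Submodule.mem_bot, ← map_mul, ← map_mul] at h1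
      exact Ideal.Quotient.eq_zero_iff_mem.1 h1
    · obtain ⟨b, rfl⟩ := Ideal.Quotient.mk_surjective b
      refine ⟨b, ?_⟩
      rw [← Ideal.Quotient.eq]
      simpa using hb

end Transport

/-! ### Matrix rings over local rings -/

section Matrix

variable {k : Type u} [Ring k]

theorem isUnit_of_mul_eq_one_of_isLocalRing [IsLocalRing k] {x y : k} (h : y * x = 1) :
    IsUnit x := by
  rcases IsLocalRing.isUnit_or_isUnit_of_add_one (show x * y + (1 - x * y) = 1 by abel) with h1 | h1
  · obtain ⟨u, hu⟩ := h1
    have h2 : x * (y * (↑u⁻¹ : k)) = 1 := by rw [← mul_assoc, ← hu, Units.mul_inv]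
    have h3 : y = y * (↑u⁻¹ : k) := by
      calc y = y * (x * (y * (↑u⁻¹ : k))) := by rw [h2, mul_one]
        _ = _ := by rw [← mul_assoc, h, one_mul]
    exact ⟨⟨x, y, by rw [h3, h2], h⟩, rfl⟩
  · have h2 : (1 - x * y) * x = 0 := by rw [sub_mul, one_mul, mul_assoc, h, mul_one, sub_self]
    have h3 := h1.mul_right_eq_zero.1 h2
    rw [h3, mul_zero] at h
    exact absurd h zero_ne_one

theorem isUnit_of_notMem_of_isLocalRing [IsLocalRing k] {m : Ideal k} (hm : m.IsMaximal) {x : k}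
    (hx : x ∉ m) : IsUnit x := by
  obtain ⟨y, hy⟩ := Ideal.IsMaximal.exists_inv hm hx
  obtain ⟨z, hz, h⟩ := hy
  rcases IsLocalRing.isUnit_or_isUnit_of_add_one h with h1 | h1
  · obtain ⟨v, hv⟩ := h1
    exact isUnit_of_mul_eq_one_of_isLocalRing (y := (↑v⁻¹ : k) * y)
      (by rw [mul_assoc, ← hv, Units.inv_mul])
  · exact absurd (Ideal.eq_top_of_isUnit_mem _ hz h1) hm.ne_top

theorem isLocalProgenerator_single [IsLocalRing k] {m : Ideal k} (hm : m.IsMaximal)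
    (hT : IsLeftTNilpotent m) {n : ℕ} (i₀ : Fin n) :
    IsLocalProgenerator (Matrix.single i₀ i₀ (1 : k)) := by
  have hmul : ∀ a b : k, Matrix.single i₀ i₀ a * Matrix.single i₀ i₀ b = Matrix.single i₀ i₀ (a * b) :=
    fun a b => Matrix.single_mul_single_same ..
  have hcorner : ∀ a : Matrix (Fin n) (Fin n) k,
      Matrix.single i₀ i₀ 1 * a * Matrix.single i₀ i₀ 1 = Matrix.single i₀ i₀ (a i₀ i₀) := by
    intro a
    rw [Matrix.single_mul_mul_single]
    simp
  have hJ : ∀ x ∈ m, Matrix.single i₀ i₀ x ∈ Ring.jacobson (Matrix (Fin n) (Fin n) k) := by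
    intro x hx
    refine mem_jacobson_iff.2 fun y => ?_
    obtain ⟨c, hc⟩ : ∃ c, c = y i₀ i₀ := ⟨_, rfl⟩
    have h1 : IsUnit (1 - c * x) := by
      rcases IsLocalRing.isUnit_or_isUnit_of_add_one (show c * x + (1 - c * x) = 1 by abel) with h | h
      · exact absurd (Ideal.eq_top_of_isUnit_mem _ (m.mul_mem_left c hx) h) hm.ne_top
      · exact h
    obtain ⟨v, hv⟩ := h1
    have h2 : (↑v⁻¹ : k) - ↑v⁻¹ * (c * x) = 1 := by
      rw [← mul_one_sub, ← hv, Units.inv_mul]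
    obtain ⟨u, hu⟩ : ∃ u, u = (↑v⁻¹ : k) := ⟨_, rfl⟩
    rw [← hu] at h2
    obtain ⟨X, hX⟩ : ∃ X, X = Matrix.single i₀ i₀ x := ⟨_, rfl⟩
    obtain ⟨U, hU⟩ : ∃ U, U = Matrix.single i₀ i₀ u := ⟨_, rfl⟩
    have h3 : U * y * X = Matrix.single i₀ i₀ (u * (c * x)) := by
      rw [hX, hU, Matrix.single_mul_mul_single, hc, mul_assoc]
    have h4 : X * (U - U * y * X) = X := by
      have : U - U * y * X = Matrix.single i₀ i₀ 1 := by
        rw [sub_eq_iff_eq_add, h3, ← Matrix.single_add, hU, ← sub_eq_iff_eq_add.1 h2]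
      rw [this, hX, hmul, mul_one]
    -- As `X y X` is `X` times the corner matrix of `c x`, the formal geometric series of `y X` sums
    -- to `1 + y X U`, with `U` the corner matrix of `(1 - c x)⁻¹`.
    refine ⟨1 + y * X * U, ?_⟩
    rw [← hX]
    have h5 : (1 + y * X * U) * (1 - y * X) = 1 - y * X + y * (X * (U - U * y * X)) := by
      noncomm_ring
    rw [h5, h4, sub_add_cancel]
  have he : Matrix.single i₀ i₀ (1 : k) * Matrix.single i₀ i₀ 1 = Matrix.single i₀ i₀ 1 := by
    rw [hmul, mul_one]
  have he0 : Matrix.single i₀ i₀ (1 : k) ≠ 0 := fun h => by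
    simpa using congrFun (congrFun h i₀) i₀
  refine ⟨he, he0, ?_, fun a => ?_, fun a ha hae => ?_⟩
  · rw [Ideal.eq_top_iff_one, ← Matrix.sum_single_one]
    refine sum_mem fun i _ => ?_
    have h1 : Matrix.single i i (1 : k) =
        Matrix.single i i₀ 1 * (Matrix.single i₀ i₀ 1 * Matrix.single i₀ i 1) := by
      simp
    rw [h1]
    exact Ideal.mul_mem_left _ _ (Ideal.subset_span ⟨_, rfl⟩)
  · simp only [hcorner, hmul]
    by_cases h : a i₀ i₀ ∈ m
    · exact Or.inl (hJ _ h)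
    · obtain ⟨v, hv⟩ := isUnit_of_notMem_of_isLocalRing hm h
      refine Or.inr ⟨Matrix.single i₀ i₀ ↑v⁻¹, ?_⟩
      simp [← hv]
  · have hax : ∀ i, a i = Matrix.single i₀ i₀ (a i i₀ i₀) := fun i => by
      rw [← hcorner, hae]
    have hxm : ∀ i, a i i₀ i₀ ∈ m := by
      intro i
      by_contra h
      obtain ⟨v, hv⟩ := isUnit_of_notMem_of_isLocalRing hm h
      have h1 : a i * Matrix.single i₀ i₀ (↑v⁻¹ : k) = Matrix.single i₀ i₀ 1 := by
        rw [hax, hmul, ← hv, Units.mul_inv]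
      exact he0 (eq_zero_of_eq_mul_jacobson (h1 ▸ Ideal.mul_mem_right _ _ (ha i)) he.symm)
    obtain ⟨n, hn1, hn⟩ := hT _ hxm
    -- The empty product is the identity matrix rather than the corner idempotent, hence `n + 1`.
    have key : ∀ n, ((List.range (n + 1)).map a).prod =
        Matrix.single i₀ i₀ ((List.range (n + 1)).map fun i => a i i₀ i₀).prod := by
      intro n
      induction n with
      | zero => simpa using hax 0
      | succ n ih => rw [List.prod_range_succ, ih, hax (n + 1), hmul, ← List.prod_range_succ]
    obtain ⟨n, rfl⟩ := Nat.exists_eq_add_of_le' hn1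
    exact ⟨n + 1, by rw [key, hn, Matrix.single_zero]⟩

end Matrix

/-! ### The endomorphism ring of `R e` -/

section Endomorphism

variable {R : Type u} [Ring R] {e : R} (he : IsLocalProgenerator e)

namespace IsLocalProgenerator

theorem coe_mul (hee : e * e = e) (p : (Ideal.span {e} : Ideal R)) : (p : R) * e = p := by
  obtain ⟨r, hr⟩ := p
  obtain ⟨b, rfl⟩ := Ideal.mem_span_singleton'.1 hr
  simp [mul_assoc, hee]

/-- The value at `e` of an endomorphism of `R e`. -/
def endValue (φ : Module.End R (Ideal.span {e} : Ideal R)) : R :=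
  φ ⟨e, Ideal.mem_span_singleton_self e⟩

include he

theorem coe_end_apply (φ : Module.End R (Ideal.span {e} : Ideal R))
    (p : (Ideal.span {e} : Ideal R)) : (φ p : R) = p * endValue φ := by
  have h : p = (p : R) • (⟨e, Ideal.mem_span_singleton_self e⟩ : (Ideal.span {e} : Ideal R)) :=
    Subtype.ext (coe_mul he.mul_self p).symm
  conv_lhs => rw [h, map_smul]
  rfl

theorem endValue_corner (φ : Module.End R (Ideal.span {e} : Ideal R)) :
    e * endValue φ * e = endValue φ := by
  rw [← he.coe_end_apply φ ⟨e, Ideal.mem_span_singleton_self e⟩]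
  exact coe_mul he.mul_self _

/-- Endomorphisms act by right multiplication, which reverses products; this is why the opposite
ring appears below. -/
theorem endValue_mul (φ ψ : Module.End R (Ideal.span {e} : Ideal R)) :
    endValue (φ * ψ) = endValue ψ * endValue φ :=
  he.coe_end_apply φ _

theorem endValue_injective :
    Function.Injective (endValue : Module.End R (Ideal.span {e} : Ideal R) → R) := by
  intro φ ψ h
  ext p
  rw [he.coe_end_apply, he.coe_end_apply, h]

theorem endValue_surjective (b : R) :
    ∃ φ : Module.End R (Ideal.span {e} : Ideal R), endValue φ = e * b * e := by
  refine ⟨((LinearMap.toSpanSingleton R R (e * b * e)).codRestrict (Ideal.span {e})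
    fun r => ?_) ∘ₗ (Ideal.span {e}).subtype, ?_⟩
  · exact Ideal.mem_span_singleton'.2 ⟨r * (e * b), by simp [mul_assoc]⟩
  · simp only [endValue, LinearMap.comp_apply, LinearMap.codRestrict_apply, Submodule.subtype_apply,
      LinearMap.toSpanSingleton_apply, smul_eq_mul, ← mul_assoc, he.mul_self]

theorem endValue_mem_or_isUnit (φ : Module.End R (Ideal.span {e} : Ideal R)) :
    endValue φ ∈ Ring.jacobson R ∨ IsUnit φ := by
  rcases he.mem_or_exists_inv (endValue φ) with h | ⟨b, hb, hb'⟩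
  · exact Or.inl (he.endValue_corner φ ▸ h)
  · rw [he.endValue_corner] at hb hb'
    obtain ⟨ψ, hψ⟩ := he.endValue_surjective b
    refine Or.inr ⟨⟨φ, ψ, he.endValue_injective ?_, he.endValue_injective ?_⟩, rfl⟩
    · rw [he.endValue_mul, hψ, hb]; rfl
    · rw [he.endValue_mul, hψ, hb']; rfl

theorem nontrivial_span : Nontrivial (Ideal.span {e} : Ideal R) :=
  ⟨⟨⟨e, Ideal.mem_span_singleton_self e⟩, 0, fun h => he.ne_zero (congrArg Subtype.val h)⟩⟩

theorem isLocalRing_end : IsLocalRing (Module.End R (Ideal.span {e} : Ideal R))ᵐᵒᵖ := by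
  have := he.nontrivial_span
  refine IsLocalRing.of_is_unit_or_is_unit_of_add_one fun {a b} hab => ?_
  rcases he.endValue_mem_or_isUnit a.unop with h | h
  · rcases he.endValue_mem_or_isUnit b.unop with h' | h'
    · refine absurd ?_ he.notMem_jacobson
      have h1 : a.unop + b.unop = 1 := congrArg MulOpposite.unop hab
      have h2 : endValue a.unop + endValue b.unop = e := congrArg endValue h1
      exact h2 ▸ add_mem h h'
    · exact Or.inr (by simpa using h'.op)
  · exact Or.inl (by simpa using h.op)

theorem exists_isMaximal_isLeftTNilpotent :
    ∃ m : Ideal (Module.End R (Ideal.span {e} : Ideal R))ᵐᵒᵖ, m.IsMaximal ∧ IsLeftTNilpotent m := by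
  let m : Ideal (Module.End R (Ideal.span {e} : Ideal R))ᵐᵒᵖ :=
    { carrier := {a | endValue a.unop ∈ Ring.jacobson R}
      zero_mem' := zero_mem (Ring.jacobson R)
      add_mem' := fun {a b} ha hb => (Ring.jacobson R).add_mem ha hb
      smul_mem' := fun a b hb => by
        have : endValue (b.unop * a.unop) ∈ Ring.jacobson R := by
          rw [he.endValue_mul]
          exact Ideal.mul_mem_left _ _ hb
        exact this }
  refine ⟨m, Ideal.isMaximal_iff.2 ⟨fun h => he.notMem_jacobson h, fun I x _ hx hxI => ?_⟩,
    fun a ha => ?_⟩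
  · rw [← Ideal.eq_top_iff_one]
    refine Ideal.eq_top_of_isUnit_mem _ hxI ?_
    simpa using ((he.endValue_mem_or_isUnit x.unop).resolve_left hx).op
  · obtain ⟨n, hn⟩ := he.nilpotent (fun i => endValue (a i).unop) ha
      (fun i => he.endValue_corner _)
    have key : ∀ n, endValue ((List.range n).map a).prod.unop =
        e * ((List.range n).map fun i => endValue (a i).unop).prod := by
      intro n
      induction n with
      | zero => simp [endValue]
      | succ n ih =>
        rw [List.prod_range_succ, MulOpposite.unop_mul, he.endValue_mul, ih, List.prod_range_succ,
          mul_assoc]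
    -- `nilpotent` allows `n = 0`; one further factor makes the product non-empty.
    refine ⟨n + 1, by omega, MulOpposite.unop_injective (he.endValue_injective ?_)⟩
    rw [key, List.prod_range_succ, hn, zero_mul, mul_zero]
    rfl

theorem exists_ringEquiv_matrix : ∃ n : ℕ, 1 ≤ n ∧
    Nonempty (R ≃+* Matrix (Fin n) (Fin n) (Module.End R (Ideal.span {e} : Ideal R))ᵐᵒᵖ) := by
  classical
  obtain ⟨ι, ⟨E⟩⟩ := he.exists_linearEquiv_of_isFlat (isFlat_self R)
  -- The coordinates of `1` generate: if one of them vanished, that coordinate would vanish on the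
  -- whole sum. So the sum is finite.
  have hfin : ∀ i, i ∈ (E.symm 1).support := by
    intro i
    rw [Finsupp.mem_support_iff]
    intro h0
    have h1 : ∀ f : ι →₀ (Ideal.span {e} : Ideal R), f i = 0 := by
      intro f
      have h2 : f = E f • E.symm 1 := by
        rw [← map_smul, smul_eq_mul, mul_one, E.symm_apply_apply]
      rw [h2, Finsupp.smul_apply, h0, smul_zero]
    have h3 := h1 (Finsupp.single i ⟨e, Ideal.mem_span_singleton_self e⟩)
    rw [Finsupp.single_eq_same] at h3
    exact he.ne_zero (congrArg Subtype.val h3)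
  have : Fintype ι := ⟨_, hfin⟩
  have hne : Nonempty ι := by
    by_contra hemp
    rw [not_nonempty_iff] at hemp
    exact he.ne_zero (E.symm.injective (Subsingleton.elim _ _))
  refine ⟨Fintype.card ι, Fintype.card_pos, ⟨?_⟩⟩
  let E' : R ≃ₗ[R] (Fin (Fintype.card ι) → (Ideal.span {e} : Ideal R)) :=
    E.symm ≪≫ₗ Finsupp.linearEquivFunOnFinite R _ ι ≪≫ₗ
      LinearEquiv.funCongrLeft R _ (Fintype.equivFin ι).symm
  let F : Rᵐᵒᵖ ≃+* Matrix (Fin (Fintype.card ι)) (Fin (Fintype.card ι))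
      (Module.End R (Ideal.span {e} : Ideal R)) :=
    (RingEquiv.moduleEndSelf R).trans (E'.conjRingEquiv.trans (endVecRingEquivMatrixEnd ..))
  exact (RingEquiv.opOp R).trans (F.op.trans RingEquiv.mopMatrix.symm)

end IsLocalProgenerator

end Endomorphism

/-! ### Categoricity and left perfectness -/

section Categoricity

variable {R : Type u} [Ring R]

theorem mk_finsupp_eq {ι M : Type u} [Zero M] [Nontrivial M] [Infinite ι]
    (h : Cardinal.mk M ≤ Cardinal.mk ι) : Cardinal.mk (ι →₀ M) = Cardinal.mk ι := by
  rw [Cardinal.mk_finsupp_of_infinite, max_eq_left h]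

theorem IsLocalProgenerator.isCategoricalIn {e : R} (he : IsLocalProgenerator e) (c : Cardinal.{u})
    (hc : Cardinal.mk R + Cardinal.aleph0 < c) : IsCategoricalIn (flatModules R) c := by
  have hR : Cardinal.mk R < c := (self_le_add_right _ _).trans_lt hc
  have hω : Cardinal.aleph0 < c := (self_le_add_left _ _).trans_lt hc
  constructor
  · have : Infinite c.out := by rw [Cardinal.infinite_iff, Cardinal.mk_out]; exact hω.le
    have : Nontrivial R := ⟨⟨e, 0, he.ne_zero⟩⟩
    refine ⟨ModuleCat.of R (c.out →₀ R), (isFlat_self R).finsupp _, ?_⟩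
    exact (mk_finsupp_eq (by rw [Cardinal.mk_out]; exact hR.le)).trans (Cardinal.mk_out c)
  · intro M N hM hN hMc hNc
    have := he.nontrivial_span
    have hP : Cardinal.mk (Ideal.span {e} : Ideal R) < c :=
      (Cardinal.mk_le_of_injective Subtype.val_injective).trans_lt hR
    -- A finite sum of copies of `R e` has cardinality below `c`, and an infinite one has the larger
    -- of the cardinalities of `ι` and `R e`, the latter being below `c`.
    have key : ∀ ι : Type u, Cardinal.mk (ι →₀ (Ideal.span {e} : Ideal R)) = c →
        Cardinal.mk ι = c := by
      intro ι h
      rcases finite_or_infinite ι with hι | hι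
      · exfalso
        have : Fintype ι := Fintype.ofFinite ι
        rcases finite_or_infinite (Ideal.span {e} : Ideal R) with hP' | hP'
        · have : Finite (ι →₀ (Ideal.span {e} : Ideal R)) :=
            Finite.of_injective _ DFunLike.coe_injective
          rw [← h] at hω
          exact absurd (Cardinal.lt_aleph0_of_finite _) hω.not_gt
        · rcases isEmpty_or_nonempty ι with hι' | hι'
          · rw [← h] at hω
            exact absurd (Cardinal.lt_aleph0_of_finite _) hω.not_gt
          · rw [Cardinal.mk_finsupp_of_infinite'] at h
            have : max (Cardinal.mk ι) (Cardinal.mk (Ideal.span {e} : Ideal R)) < c :=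
              max_lt ((Cardinal.lt_aleph0_of_finite ι).trans hω) hP
            exact this.ne h
      · rw [Cardinal.mk_finsupp_of_infinite] at h
        rcases max_choice (Cardinal.mk ι) (Cardinal.mk (Ideal.span {e} : Ideal R)) with h1 | h1
        · rw [← h1, h]
        · exact absurd (h1.symm.trans h) hP.ne
    obtain ⟨ι, ⟨E⟩⟩ := he.exists_linearEquiv_of_isFlat hM
    obtain ⟨κ, ⟨F⟩⟩ := he.exists_linearEquiv_of_isFlat hN
    have h1 := key ι ((Cardinal.mk_congr E.toEquiv).trans hMc)
    have h2 := key κ ((Cardinal.mk_congr F.toEquiv).trans hNc)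
    obtain ⟨f⟩ := Cardinal.eq.1 (h1.trans h2.symm)
    exact ⟨E.symm ≪≫ₗ Finsupp.domLCongr f ≪≫ₗ F⟩

theorem IsCategoricalIn.nonempty_linearEquiv {c : Cardinal.{u}}
    (hc : Cardinal.mk R + Cardinal.aleph0 < c) (h : IsCategoricalIn (flatModules R) c)
    [Nontrivial R] {M : Type u} [AddCommGroup M] [Module R M] [Nontrivial M] (hM : IsFlat R M)
    (hMc : Cardinal.mk M ≤ c) : Nonempty ((c.out →₀ M) ≃ₗ[R] (c.out →₀ R)) := by
  have hR : Cardinal.mk R < c := (self_le_add_right _ _).trans_lt hc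
  have hω : Cardinal.aleph0 < c := (self_le_add_left _ _).trans_lt hc
  have : Infinite c.out := by rw [Cardinal.infinite_iff, Cardinal.mk_out]; exact hω.le
  exact h.2 (ModuleCat.of R (c.out →₀ M)) (ModuleCat.of R (c.out →₀ R)) (hM.finsupp _)
    ((isFlat_self R).finsupp _)
    ((mk_finsupp_eq (by rw [Cardinal.mk_out]; exact hMc)).trans (Cardinal.mk_out c))
    ((mk_finsupp_eq (by rw [Cardinal.mk_out]; exact hR.le)).trans (Cardinal.mk_out c))

/-- A Bass module is a summand of a free module, hence projective, which gives the chain condition.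
Fullness of `e` comes from `(R e)^(c) ≅ R^(c)`. -/
theorem IsCategoricalIn.exists_isLocalProgenerator {c : Cardinal.{u}}
    (hc : Cardinal.mk R + Cardinal.aleph0 < c) (h : IsCategoricalIn (flatModules R) c) :
    ∃ e : R, IsLocalProgenerator e := by
  have hR : Cardinal.mk R < c := (self_le_add_right _ _).trans_lt hc
  have hω : Cardinal.aleph0 < c := (self_le_add_left _ _).trans_lt hc
  have hnt : Nontrivial R := by
    by_contra hn
    rw [not_nontrivial_iff_subsingleton] at hn
    obtain ⟨M, -, hM⟩ := h.1
    have : Subsingleton M := Module.subsingleton R M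
    rw [← hM] at hω
    exact absurd (Cardinal.lt_aleph0_of_finite _) hω.not_gt
  have : Nonempty c.out := by
    rw [← Cardinal.mk_ne_zero_iff, Cardinal.mk_out]
    exact (Cardinal.aleph0_pos.trans hω).ne'
  have i₀ : c.out := Classical.arbitrary _
  have hstat : IsStationary R := IsStationary.of_forall_projective fun a => by
    rcases subsingleton_or_nontrivial (Bass a) with hs | hs
    · infer_instance
    · obtain ⟨E⟩ := h.nonempty_linearEquiv hc (isFlat_bass a) (by
        refine (Cardinal.mk_le_of_surjective (Submodule.mkQ_surjective (bassRel a))).trans ?_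
        rw [Cardinal.mk_finsupp_lift_of_infinite]
        simpa using ⟨hω.le, hR.le⟩)
      have : Module.Projective R (c.out →₀ Bass a) := Module.Projective.of_equiv E.symm
      exact Module.Projective.of_split (Finsupp.lsingle i₀) (Finsupp.lapply i₀)
        (by ext x; simp)
  obtain ⟨e, he, heJ, hinv⟩ := hstat.exists_local_idempotent
  refine ⟨e, hstat.isLocalProgenerator he heJ ?_ hinv⟩
  have hne : e ≠ 0 := fun h0 => heJ (h0 ▸ zero_mem _)
  have : Nontrivial (Ideal.span {e} : Ideal R) :=
    ⟨⟨⟨e, Ideal.mem_span_singleton_self e⟩, 0, fun h => hne (congrArg Subtype.val h)⟩⟩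
  have hflat : IsFlat R (Ideal.span {e} : Ideal R) := by
    refine (isFlat_self R).of_retract ((LinearMap.toSpanSingleton R R e).codRestrict _ fun r =>
      Ideal.mem_span_singleton'.2 ⟨r, rfl⟩) (Ideal.span {e}).subtype ?_
    ext p
    exact IsLocalProgenerator.coe_mul he p
  obtain ⟨E⟩ := h.nonempty_linearEquiv hc hflat
    ((Cardinal.mk_le_of_injective Subtype.val_injective).trans hR.le)
  rw [Ideal.eq_top_iff_one]
  -- The source is generated by elements fixed by `e`, so all coordinates of the images lie in `R e
  -- R`; some image has coordinate `1`.
  have key : ∀ f, E f i₀ ∈ Ideal.span (Set.range fun b : R => e * b) := by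
    intro f
    induction f using Finsupp.induction_linear with
    | zero => simp
    | add f g hf hg =>
      rw [map_add, Finsupp.add_apply]
      exact add_mem hf hg
    | single i p =>
      have h1 : Finsupp.single i p = (p : R) • e • Finsupp.single i
          (⟨e, Ideal.mem_span_singleton_self e⟩ : (Ideal.span {e} : Ideal R)) := by
        rw [← mul_smul, IsLocalProgenerator.coe_mul he, Finsupp.smul_single]
        congr 1
        exact Subtype.ext (IsLocalProgenerator.coe_mul he p).symm
      rw [h1, map_smul, map_smul, Finsupp.smul_apply, Finsupp.smul_apply]
      exact Ideal.mul_mem_left _ _ (Ideal.subset_span ⟨_, rfl⟩)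
  simpa using key (E.symm (Finsupp.single i₀ 1))

theorem IsLeftPerfect.isStationary (h : IsLeftPerfect R) : IsStationary R :=
  IsStationary.of_forall_projective fun a => h _ (bass_countably_generated a) (isFlat_bass a)

theorem IsLocalProgenerator.isLeftPerfect {e : R} (he : IsLocalProgenerator e) :
    IsLeftPerfect R := by
  intro M _ _ _ hM
  obtain ⟨ι, ⟨E⟩⟩ := he.exists_linearEquiv_of_isFlat hM
  have : Module.Projective R (Ideal.span {e} : Ideal R) :=
    Module.Projective.of_split (Ideal.span {e}).subtype
      ((LinearMap.toSpanSingleton R R e).codRestrict _ fun r =>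
        Ideal.mem_span_singleton'.2 ⟨r, rfl⟩)
      (by ext p; exact IsLocalProgenerator.coe_mul he.mul_self p)
  have : Module.Projective R (ι →₀ (Ideal.span {e} : Ideal R)) := by
    classical exact Module.Projective.of_equiv (finsuppLequivDFinsupp R).symm
  exact Module.Projective.of_equiv E

/-- Over `R / J` the radical vanishes, so the local endomorphism ring is a division ring. -/
theorem IsLocalProgenerator.exists_quotient_ringEquiv {e : R} (he : IsLocalProgenerator e) :
    ∃ (n : ℕ) (D : Type u) (_ : DivisionRing D), 1 ≤ n ∧
      Nonempty ((R ⧸ Ring.jacobson R) ≃+* Matrix (Fin n) (Fin n) D) := by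
  have hq := he.quotient
  obtain ⟨n, hn, ⟨φ⟩⟩ := hq.exists_ringEquiv_matrix
  have := hq.isLocalRing_end
  have hu : ∀ a : (Module.End (R ⧸ Ring.jacobson R)
      (Ideal.span {Ideal.Quotient.mk (Ring.jacobson R) e} : Ideal _))ᵐᵒᵖ, IsUnit a ∨ a = 0 := by
    intro a
    rcases hq.endValue_mem_or_isUnit a.unop with h | h
    · right
      rw [Ring.jacobson_quotient_jacobson, Submodule.mem_bot] at h
      exact MulOpposite.unop_injective (hq.endValue_injective h)
    · exact Or.inl (by simpa using h.op)
  exact ⟨n, _, DivisionRing.ofIsUnitOrEqZero hu, hn, ⟨φ⟩⟩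

theorem exists_isLocalProgenerator_of_quotient_ringEquiv (h : IsLeftPerfect R) {n : ℕ}
    {D : Type u} [DivisionRing D] (hn : 1 ≤ n)
    (φ : (R ⧸ Ring.jacobson R) ≃+* Matrix (Fin n) (Fin n) D) :
    ∃ e : R, IsLocalProgenerator e := by
  have hloc : IsLocalRing D := IsLocalRing.of_is_unit_or_is_unit_of_add_one fun {a b} hab => by
    by_cases ha : a = 0
    · right
      rw [ha, zero_add] at hab
      exact hab ▸ isUnit_one
    · exact Or.inl (isUnit_iff_ne_zero.2 ha)
  have hs := (isLocalProgenerator_single (Ideal.bot_isMaximal (K := D))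
    (fun a ha => ⟨1, le_rfl, by simpa using ha 0⟩) (⟨0, hn⟩ : Fin n)).map φ.symm
  obtain ⟨e₀, he₀⟩ := Ideal.Quotient.mk_surjective (φ.symm (Matrix.single ⟨0, hn⟩ ⟨0, hn⟩ 1))
  rw [← he₀] at hs
  obtain ⟨e, he, hee⟩ := h.isStationary.exists_idempotent_lift
    (Ideal.Quotient.eq.1 (by rw [map_mul, hs.mul_self]))
  exact ⟨e, h.isStationary.isLocalProgenerator_of_quotient he (hee ▸ hs)⟩

end Categoricity

end FlatCat

theorem theorem3p14 (R : Type u) [Ring R] :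
    List.TFAE [
      ∀ c : Cardinal.{u}, Cardinal.mk R + Cardinal.aleph0 < c →
        FlatCat.IsCategoricalIn (FlatCat.flatModules R) c,
      ∃ c : Cardinal.{u}, Cardinal.mk R + Cardinal.aleph0 < c ∧
        FlatCat.IsCategoricalIn (FlatCat.flatModules R) c,
      FlatCat.IsLeftPerfect R ∧
        ∃ (n : ℕ) (D : Type u) (_ : DivisionRing D), 1 ≤ n ∧
          Nonempty ((R ⧸ Ring.jacobson R) ≃+* Matrix (Fin n) (Fin n) D),
      ∃ (n : ℕ) (k : Type u) (_ : Ring k), 1 ≤ n ∧ IsLocalRing k ∧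
        (∃ m : Ideal k, m.IsMaximal ∧ FlatCat.IsLeftTNilpotent m) ∧
        Nonempty (R ≃+* Matrix (Fin n) (Fin n) k)] := by
  tfae_have 1 → 2 := fun h =>
    ⟨Order.succ (Cardinal.mk R + Cardinal.aleph0), Order.lt_succ _, h _ (Order.lt_succ _)⟩
  tfae_have 2 → 3 := by
    rintro ⟨c, hc, h⟩
    obtain ⟨e, he⟩ := h.exists_isLocalProgenerator hc
    exact ⟨he.isLeftPerfect, he.exists_quotient_ringEquiv⟩
  tfae_have 3 → 4 := by
    rintro ⟨hp, n, D, _, hn, ⟨φ⟩⟩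
    obtain ⟨e, he⟩ := FlatCat.exists_isLocalProgenerator_of_quotient_ringEquiv hp hn φ
    obtain ⟨m, hm, hφ⟩ := he.exists_ringEquiv_matrix
    exact ⟨m, _, _, hm, he.isLocalRing_end, he.exists_isMaximal_isLeftTNilpotent, hφ⟩
  tfae_have 4 → 1 := by
    rintro ⟨n, k, _, hn, _, ⟨m, hm, hT⟩, ⟨φ⟩⟩ c hc
    exact ((FlatCat.isLocalProgenerator_single hm hT ⟨0, hn⟩).map φ.symm).isCategoricalIn c hc
  tfae_finish
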